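/- All graphs are finite and simple. For a graph $G$ let $\mathrm{MAD}(G)=\max_H \frac{2|E(H)|}{|V(H)|}$, where $H$ ranges over all subgraphs of $G$ with at least one vertex (and $\mathrm{MAD}(G)=0$ if $G$ has no vertices). An orientation of $G$ (each edge receives exactly one of its two directions) is called proper if any two adjacent vertices have different outdegrees, and the proper chromatic number $\vec{\chi}(G)$ is the minimum, over all proper orientations of $G$, of the largest outdegree of a vertex. Every bipartite graph $G$ has a proper orientation and satisfies $$\bigl\lceil \tfrac12 \mathrm{MAD}(G)\bigr\rceil \le \vec{\chi}(G)\le \bigl\lceil \tfrac12 \mathrm{MAD}(G)\bigr\rceil+3 .$$ This bound is tight: for every integer $k\ge 1$ there is a bipartite graph $G$ with $\bigl\lceil \tfrac12 \mathrm{MAD}(G)\bigr\rceil=k$ and $\vec{\chi}(G)=k+3$. -/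

import Mathlib

namespace SimpleGraph

/-- The maximum average degree `max 2|E(H)| / |V(H)|` of a finite graph, over all subgraphs `H`
with at least one vertex (and `0` for the graph with no vertices). For a finite vertex type this
is the supremum of a finite set of reals, hence a maximum. -/
noncomputable def maxAvgDegree {V : Type*} (G : SimpleGraph V) : ℝ :=
  sSup {d : ℝ | ∃ H : G.Subgraph, H.verts.Nonempty ∧
    d = 2 * (H.edgeSet.ncard : ℝ) / (H.verts.ncard : ℝ)}

/-- The digraph `D` is an orientation of the graph `G`: the arcs of `D` lie on the edges of `G`,
and every edge of `G` carries exactly one of its two possible arcs. -/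
structure IsOrientation {V : Type*} (G : SimpleGraph V) (D : Digraph V) : Prop where
  adj_iff : ∀ u v, G.Adj u v ↔ D.Adj u v ∨ D.Adj v u
  asymm : ∀ u v, D.Adj u v → ¬ D.Adj v u

/-- An orientation is proper if adjacent vertices have different outdegrees. The outdegree of `v`
in `D` is the number of arcs leaving `v`. -/
structure IsProperOrientation {V : Type*} (G : SimpleGraph V) (D : Digraph V) : Prop extends
    G.IsOrientation D where
  outdegree_ne : ∀ u v, G.Adj u v → {w | D.Adj u w}.encard ≠ {w | D.Adj v w}.encard

/-- The minimum, over all proper orientations of `G`, of the largest outdegree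
(`⊤` if there were no proper orientation). -/
noncomputable def properChromaticNumber {V : Type*} (G : SimpleGraph V) : ℕ∞ :=
  ⨅ D ∈ {D : Digraph V | G.IsProperOrientation D}, ⨆ v : V, {w | D.Adj v w}.encard

end SimpleGraph

/-! The lower bound is averaging: if all outdegrees are at most `m`, every subgraph has at most `m`
edges per vertex. Conversely, for `k = ⌈MAD/2⌉`, Hall's theorem gives an orientation with all
outdegrees at most `k`; hence in any orientation a vertex set contains at most `k` arcs per vertex.

For the upper bound let `X` be one colour class. Among the orientations with outdegrees at most `k +
2` on `X` and `k + 3` off `X`, take one of maximal lexicographic `potential`. Its leading terms push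
vertices off `X` towards `k + 3` and vertices of `X` towards `k + 2`, so that the two sides avoid
each other's large values. The vertices off `X` of degree `k + 2` (tight) cannot reach `k + 3`; they
clash with capped vertices only if they are sources. `attains_of_not_good` excludes this: a surplus
arc is moved through the graph until it is absorbed, and if it never can be, the vertices it reaches
contain more than `k` arcs per vertex.

By `Optimal.of_outdeg_eq`, one kind of conflict survives: an `x` in `X` of outdegree `k + 1` whose
arc to a slack vertex is the only arc entering that vertex. Reversing a link through the slack
vertex moves the value `k + 1` onwards and gives another optimal orientation, so `walk_end` carries
facts about `x` along walks of links. `exists_proper_of_orients` then reverses, at all slack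
vertices reached, every arc to a non-capped vertex. These slack vertices drop to at most `k`, the
heads rise from `k` to `k + 1`, and no conflict is left.

Sharpness comes from a blown-up tree. With outdegrees at most `k + 2`, some child of every branching
node sends all its arcs up; suitable children then forbid the values `k`, `k + 1` and `k + 2` one
after another. -/

open Finset

namespace SimpleGraph

/-! ### Orientations as relations, reversal of an arc, arcs inside a set -/

section Orientations

open scoped Classical

variable {V : Type*} [Fintype V]

/-- The relation `D` chooses exactly one direction for every edge of `G`, and nothing else. -/
structure Orients (G : SimpleGraph V) (D : V → V → Prop) : Prop where
  adj_iff : ∀ u v, G.Adj u v ↔ D u v ∨ D v u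
  asymm : ∀ u v, D u v → ¬ D v u

/-- The outdegree of `v` in the relation `D`. -/
noncomputable def outdeg (D : V → V → Prop) (v : V) : ℕ := #{w | D v w}

/-- The indegree of `v` in the relation `D`. -/
noncomputable def indeg (D : V → V → Prop) (v : V) : ℕ := #{w | D w v}

/-- The number of neighbours of `v`. -/
noncomputable def deg (G : SimpleGraph V) (v : V) : ℕ := #{w | G.Adj v w}

/-- Reverse the arc from `a` to `b`. -/
def flipArc (D : V → V → Prop) (a b : V) : V → V → Prop :=
  fun u v => (u = b ∧ v = a) ∨ (D u v ∧ ¬ (u = a ∧ v = b))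

variable {G : SimpleGraph V} {D D' : V → V → Prop} {a b u v w : V}

omit [Fintype V] in
theorem Orients.adj (h : G.Orients D) (huv : D u v) : G.Adj u v := (h.adj_iff u v).2 (.inl huv)

omit [Fintype V] in
theorem Orients.ne (h : G.Orients D) (huv : D u v) : u ≠ v := (h.adj huv).ne

theorem Orients.outdeg_add_indeg (h : G.Orients D) (v : V) :
    outdeg D v + indeg D v = G.deg v := by
  unfold outdeg indeg deg
  rw [← card_union_of_disjoint]
  · congr 1
    ext w
    simp [h.adj_iff]
  · rw [Finset.disjoint_left]
    intro w hw hw'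
    simp only [mem_filter, mem_univ, true_and] at hw hw'
    exact h.asymm _ _ hw hw'

omit [Fintype V] in
theorem Orients.flipArc (h : G.Orients D) (hab : D a b) : G.Orients (flipArc D a b) := by
  constructor
  · intro u v
    rw [h.adj_iff]
    unfold SimpleGraph.flipArc
    by_cases h1 : u = a ∧ v = b
    · obtain ⟨rfl, rfl⟩ := h1; simp [hab]
    · by_cases h2 : u = b ∧ v = a
      · obtain ⟨rfl, rfl⟩ := h2; simp [hab]
      · tauto
  · intro u v
    have := h.asymm u v
    have := h.asymm a b hab
    have := h.ne hab
    unfold SimpleGraph.flipArc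
    rintro (⟨rfl, rfl⟩ | ⟨h1, h2⟩) (⟨rfl, h3⟩ | ⟨h3, h4⟩) <;> tauto

omit [Fintype V] in
theorem flipArc_self (D : V → V → Prop) (a b : V) : flipArc D a b b a := .inl ⟨rfl, rfl⟩

omit [Fintype V] in
theorem flipArc_iff_of_ne (h1 : ¬ (u = a ∧ v = b)) (h2 : ¬ (u = b ∧ v = a)) :
    flipArc D a b u v ↔ D u v := by
  unfold flipArc; tauto

omit [Fintype V] in
theorem Orients.not_flipArc (h : G.Orients D) (hab : D a b) : ¬ SimpleGraph.flipArc D a b a b :=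
  (h.flipArc hab).asymm _ _ (flipArc_self D a b)

theorem Orients.outdeg_flipArc_tail (h : G.Orients D) (hab : D a b) :
    outdeg (SimpleGraph.flipArc D a b) a + 1 = outdeg D a := by
  unfold outdeg
  have hne := h.ne hab
  have : ({w | D a w} : Finset V) = insert b ({w | SimpleGraph.flipArc D a b a w} : Finset V) := by
    ext w
    simp only [mem_filter, mem_univ, true_and, mem_insert, SimpleGraph.flipArc]
    by_cases hw : w = b
    · simp [hw, hab]
    · simp [hw, hne]
  rw [this, card_insert_of_notMem]
  simpa using h.not_flipArc hab

theorem Orients.outdeg_flipArc_head (h : G.Orients D) (hab : D a b) :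
    outdeg (SimpleGraph.flipArc D a b) b = outdeg D b + 1 := by
  unfold outdeg
  have hne := h.ne hab
  have : ({w | SimpleGraph.flipArc D a b b w} : Finset V) = insert a ({w | D b w} : Finset V) := by
    ext w
    simp only [mem_filter, mem_univ, true_and, mem_insert, SimpleGraph.flipArc]
    simp [hne.symm]
  rw [this, card_insert_of_notMem]
  simpa using h.asymm _ _ hab

theorem outdeg_flipArc_of_ne (ha : v ≠ a) (hb : v ≠ b) :
    outdeg (flipArc D a b) v = outdeg D v := by
  unfold outdeg
  congr 1
  ext w
  simp [flipArc, ha, hb]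

theorem outdeg_le_of_imp (h : ∀ w, D v w → D' v w) : outdeg D v ≤ outdeg D' v :=
  card_le_card fun w hw => by simpa using h w (by simpa using hw)

theorem outdeg_congr (h : ∀ w, D v w ↔ D' v w) : outdeg D v = outdeg D' v :=
  le_antisymm (outdeg_le_of_imp fun w => (h w).1) (outdeg_le_of_imp fun w => (h w).2)

theorem indeg_congr (h : ∀ w, D w v ↔ D' w v) : indeg D v = indeg D' v := by
  unfold indeg; simp only [h]

theorem sum_lt_sum_of_pair {f g : V → ℕ} (hab : a ≠ b) (h : ∀ v, v ≠ a → v ≠ b → f v = g v)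
    (hlt : f a + f b < g a + g b) : ∑ v, f v < ∑ v, g v := by
  have key : ∀ f : V → ℕ, ∑ v, f v = f a + (f b + ∑ v ∈ (univ.erase a).erase b, f v) := by
    intro f
    rw [add_sum_erase _ f (by simpa using hab.symm), add_sum_erase _ f (mem_univ a)]
  rw [key f, key g]
  have : ∑ v ∈ (univ.erase a).erase b, f v = ∑ v ∈ (univ.erase a).erase b, g v := by
    refine sum_congr rfl fun v hv => ?_
    simp only [mem_erase, mem_univ, and_true] at hv
    exact h v hv.2 hv.1
  omega

omit [Fintype V] in
/-- The number of arcs of an orientation inside a vertex set depends on the graph only. -/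
theorem Orients.two_mul_sum_card_inside (h : G.Orients D) (S : Finset V) :
    2 * ∑ u ∈ S, #{w ∈ S | D u w} = ∑ u ∈ S, #{w ∈ S | G.Adj u w} := by
  have h1 : ∀ u, #{w ∈ S | G.Adj u w} = #{w ∈ S | D u w} + #{w ∈ S | D w u} := by
    intro u
    rw [← card_union_of_disjoint]
    · congr 1
      ext w
      simp only [mem_filter, mem_union, h.adj_iff]
      tauto
    · rw [Finset.disjoint_left]
      intro w hw hw'
      simp only [mem_filter] at hw hw'
      exact h.asymm _ _ hw.2 hw'.2
  have h2 : ∑ u ∈ S, #{w ∈ S | D w u} = ∑ u ∈ S, #{w ∈ S | D u w} := by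
    simp only [card_filter]
    exact sum_comm
  simp only [h1, sum_add_distrib, h2]
  ring

/-- The count is the same for `D` and `D₀`. This is how sparsity of the graph enters the exchange
argument. -/
theorem Orients.sum_card_inside_le {D₀ : V → V → Prop} {k : ℕ} (h : G.Orients D)
    (h₀ : G.Orients D₀) (hk : ∀ v, outdeg D₀ v ≤ k) (S : Finset V) :
    ∑ u ∈ S, #{w ∈ S | D u w} ≤ k * #S := by
  have e : ∑ u ∈ S, #{w ∈ S | D u w} = ∑ u ∈ S, #{w ∈ S | D₀ u w} := by
    have := h.two_mul_sum_card_inside S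
    have := h₀.two_mul_sum_card_inside S
    omega
  rw [e, mul_comm, ← smul_eq_mul]
  refine sum_le_card_nsmul _ _ _ fun u _ => le_trans ?_ (hk u)
  exact card_le_card fun w hw => by simp at hw ⊢; exact hw.2

end Orientations

/-! ### Admissible orientations and moving a surplus arc -/

section States

open scoped Classical

variable {V : Type*} [Fintype V]

/-- The vertices outside `X` of degree `k + 2`. -/
def IsTight (G : SimpleGraph V) (X : Set V) (k : ℕ) (v : V) : Prop := v ∉ X ∧ G.deg v = k + 2

/-- Orientations with outdegrees at most `k + 2` on `X` and at most `k + 3` elsewhere. -/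
structure Admissible (G : SimpleGraph V) (X : Set V) (k : ℕ) (D : V → V → Prop) : Prop where
  orients : G.Orients D
  le_mem : ∀ v ∈ X, outdeg D v ≤ k + 2
  le_notMem : ∀ v, v ∉ X → outdeg D v ≤ k + 3

/-- The vertices of `X` with the largest outdegree that is allowed there. -/
noncomputable def capped (X : Set V) (k : ℕ) (D : V → V → Prop) : Finset V :=
  {v | v ∈ X ∧ outdeg D v = k + 2}

/-- The vertex `z` has at least two neighbours outside `C`. -/
def Loose (G : SimpleGraph V) (C : Finset V) (z : V) : Prop := 2 ≤ #{x | G.Adj z x ∧ x ∉ C}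

/-- Either `z` has an in-neighbour in `C`, or `z` is loose with exactly one in-neighbour. -/
def Good (G : SimpleGraph V) (C : Finset V) (D : V → V → Prop) (z : V) : Prop :=
  (∃ x ∈ C, D x z) ∨ (G.Loose C z ∧ indeg D z = 1)

/-- The total amount by which outdegrees exceed `k + 1` at vertices neither in `X` nor tight. -/
noncomputable def excess (G : SimpleGraph V) (X : Set V) (k : ℕ) (D : V → V → Prop) : ℕ :=
  ∑ v with v ∉ X ∧ ¬ G.IsTight X k v, (outdeg D v - (k + 1))

/-- The number of good tight vertices. -/
noncomputable def numGood (G : SimpleGraph V) (X : Set V) (k : ℕ) (D : V → V → Prop) : ℕ :=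
  #{z | G.IsTight X k z ∧ G.Good (capped X k D) D z}

/-- There is an admissible orientation whose excess, number of capped vertices and number of good
vertices are lexicographically at least the given numbers, the first one in the strong sense. -/
def Attains (G : SimpleGraph V) (X : Set V) (k e c g : ℕ) : Prop :=
  ∃ D, G.Admissible X k D ∧ e ≤ G.excess X k D ∧
    (c < #(capped X k D) ∨ c ≤ #(capped X k D) ∧ g ≤ G.numGood X k D)

variable {G : SimpleGraph V} {X : Set V} {k : ℕ} {D D' : V → V → Prop} {C : Finset V}
  {a b u v w x y z : V}

theorem mem_capped : v ∈ capped X k D ↔ v ∈ X ∧ outdeg D v = k + 2 := by simp [capped]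

theorem Good.congr (h : G.Good C D z) (h' : ∀ x, D x z ↔ D' x z) : G.Good C D' z := by
  unfold Good at *
  rwa [← indeg_congr h', ← exists_congr fun x => and_congr_right fun _ => h' x]

/-- Make `w` the only in-neighbour of `z`. -/
def setSource (G : SimpleGraph V) (D : V → V → Prop) (z w : V) : V → V → Prop :=
  fun a b => if a = z then G.Adj z b ∧ b ≠ w else if b = z then a = w else D a b

omit [Fintype V] in
theorem Orients.setSource (h : G.Orients D) (hzw : G.Adj z w) : G.Orients (G.setSource D z w) := by
  have := hzw.ne
  constructor
  · intro a b
    unfold SimpleGraph.setSource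
    by_cases ha : a = z
    · subst ha
      by_cases hb : b = a
      · subst hb; simp [this]
      · by_cases hb : b = w
        · subst hb; simp [hzw, hzw.ne.symm]
        · simp_all
    · by_cases hb : b = z
      · subst hb
        by_cases hb : a = w
        · subst hb; simp [hzw.symm, hzw.ne.symm]
        · simp_all [G.adj_comm]
      · simp [ha, hb, h.adj_iff]
  · intro a b
    have := h.asymm a b
    unfold SimpleGraph.setSource
    by_cases ha : a = z <;> by_cases hb : b = z <;> simp_all

/-- A loose tight vertex can be made good without loss elsewhere. -/
theorem attains_of_loose (hX : ∀ u v, G.Adj u v → (u ∈ X ↔ v ∉ X)) (hD : G.Admissible X k D)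
    (hz : G.IsTight X k z) (hl : G.Loose (capped X k D) z) :
    G.Attains X k (G.excess X k D) #(capped X k D)
      #{y | G.IsTight X k y ∧ (y = z ∨ G.Good (capped X k D) D y)} := by
  by_cases hg : G.Good (capped X k D) D z
  · refine ⟨D, hD, le_rfl, .inr ⟨le_rfl, card_le_card fun y hy => ?_⟩⟩
    simp only [mem_filter, mem_univ, true_and] at hy ⊢
    obtain ⟨h1, rfl | h2⟩ := hy
    · exact ⟨h1, hg⟩
    · exact ⟨h1, h2⟩
  have hO := hD.orients
  -- Any non-capped neighbour can serve as the only in-neighbour of `z`: it gains at most one arc,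
  -- and capped vertices lose none because none of them pointed to `z`.
  obtain ⟨w, hw⟩ : ({x | G.Adj z x ∧ x ∉ capped X k D} : Finset V).Nonempty := by
    rw [← card_pos]; unfold Loose at hl; omega
  simp only [mem_filter, mem_univ, true_and] at hw
  obtain ⟨hzw, hwC⟩ := hw
  have hzX := hz.1
  have hwX : w ∈ X := by have := hX _ _ hzw; tauto
  set D' := G.setSource D z w with hD'
  have hO' : G.Orients D' := hO.setSource hzw
  have hnot : ∀ x ∈ capped X k D, ¬ D x z := fun x hx hxz => hg (.inl ⟨x, hx, hxz⟩)
  have hin : ∀ x, D' x z ↔ x = w := by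
    intro x
    by_cases hx : x = z
    · subst hx; simp [hD', setSource, hzw.ne]
    · simp [hD', setSource, hx]
  have hfree : ∀ a b, a ≠ z → b ≠ z → (D' a b ↔ D a b) := by
    intro a b ha hb; simp [hD', setSource, ha, hb]
  have hY : ∀ y, y ∉ X → y ≠ z → ∀ x, (D' y x ↔ D y x) ∧ (D' x y ↔ D x y) := by
    intro y hy hyz x
    by_cases hx : x = z
    · subst hx
      have : ¬ G.Adj y x := fun h => by have := hX _ _ h; tauto
      have h1 := hO.adj_iff y x
      have h2 := hO'.adj_iff y x
      tauto
    · exact ⟨hfree _ _ hyz hx, hfree _ _ hx hyz⟩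
  have hX1 : ∀ x, x ≠ z → x ≠ w → outdeg D' x ≤ outdeg D x := by
    intro x hxz hxw
    refine outdeg_le_of_imp fun u hu => ?_
    by_cases huz : u = z
    · subst huz; exact absurd ((hin x).1 hu) hxw
    · exact (hfree _ _ hxz huz).1 hu
  have hX2 : ∀ x ∈ capped X k D, outdeg D' x = outdeg D x := by
    intro x hx
    have hxz : x ≠ z := by rintro rfl; exact hzX (mem_capped.1 hx).1
    have hxw : x ≠ w := by rintro rfl; exact hwC hx
    refine outdeg_congr fun u => ?_
    by_cases huz : u = z
    · subst huz
      simp [hin, hxw, hnot x hx]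
    · exact hfree _ _ hxz huz
  have hw1 : outdeg D' w ≤ outdeg D w + 1 := by
    have : ({u | D' w u} : Finset V) ⊆ insert z ({u | D w u} : Finset V) := by
      intro u hu
      simp only [mem_filter, mem_univ, true_and, mem_insert] at hu ⊢
      by_cases huz : u = z
      · exact .inl huz
      · exact .inr ((hfree _ _ hzw.ne.symm huz).1 hu)
    exact (card_le_card this).trans (card_insert_le _ _)
  have hwlt : outdeg D w ≤ k + 1 := by
    have h1 := hD.le_mem w hwX
    have h2 : outdeg D w ≠ k + 2 := fun h => hwC (mem_capped.2 ⟨hwX, h⟩)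
    omega
  have hsub : capped X k D ⊆ capped X k D' := by
    intro x hx
    rw [mem_capped, hX2 x hx]
    exact mem_capped.1 hx
  refine ⟨D', ⟨hO', ?_, ?_⟩, ?_, ?_⟩
  · intro x hx
    by_cases hxw : x = w
    · subst hxw; omega
    · exact (hX1 x (by rintro rfl; exact hzX hx) hxw).trans (hD.le_mem x hx)
  · intro y hy
    by_cases hyz : y = z
    · subst hyz
      have h1 := hO'.outdeg_add_indeg y
      have h2 := hz.2
      omega
    · rw [outdeg_congr fun x => (hY y hy hyz x).1]; exact hD.le_notMem y hy
  · refine le_of_eq (sum_congr rfl fun y hy => ?_)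
    simp only [mem_filter, mem_univ, true_and] at hy
    rw [outdeg_congr fun x => (hY y hy.1 (by rintro rfl; exact hy.2 hz) x).1]
  · by_cases hwk : outdeg D' w = k + 2
    · refine .inl (card_lt_card ⟨hsub, fun h => hwC (h (mem_capped.2 ⟨hwX, hwk⟩))⟩)
    · have heq : capped X k D' = capped X k D := by
        refine Subset.antisymm (fun x hx => ?_) hsub
        rw [mem_capped] at hx
        have hxw : x ≠ w := by rintro rfl; exact hwk hx.2
        have := hX1 x (by rintro rfl; exact hzX hx.1) hxw
        have := hD.le_mem x hx.1
        exact mem_capped.2 ⟨hx.1, by omega⟩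
      refine .inr ⟨by rw [heq], card_le_card fun y hy => ?_⟩
      simp only [mem_filter, mem_univ, true_and] at hy ⊢
      refine ⟨hy.1, ?_⟩
      rw [heq]
      by_cases hyz : y = z
      · subst hyz
        refine .inr ⟨hl, ?_⟩
        have : ({x | D' x y} : Finset V) = {w} := by ext x; simp [hin]
        rw [indeg, this, card_singleton]
      · exact (hy.2.resolve_left hyz).congr fun x => (hY y hy.1.1 hyz x).2.symm

/-- An orientation with outdegrees prescribed by `C` and `f`, except for one more arc leaving `v`. -/
structure Overloaded (G : SimpleGraph V) (X : Set V) (k : ℕ) (C : Finset V) (f : V → ℕ) (g : ℕ)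
    (D : V → V → Prop) (v : V) : Prop where
  orients : G.Orients D
  eq_capped : ∀ x ∈ C, outdeg D x = k + 2 + if x = v then 1 else 0
  le_mem : ∀ x ∈ X, x ∉ C → outdeg D x ≤ k + 1
  eq_notMem : ∀ y, y ∉ X → ¬ G.IsTight X k y → outdeg D y = f y + if y = v then 1 else 0
  notMem_eq : v ∉ X → ¬ G.IsTight X k v → f v = k + 3
  mem_imp : v ∈ X → v ∈ C
  not_loose : G.IsTight X k v → ¬ G.Loose C v
  no_source : G.IsTight X k v → ∀ x ∈ C, ¬ D x v
  le_card : g ≤ #{z | G.IsTight X k z ∧ (z = v ∨ G.Good C D z)}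

/-- Arcs along which the surplus of an overloaded orientation can be moved. -/
def Passes (G : SimpleGraph V) (X : Set V) (k : ℕ) (C : Finset V) (f : V → ℕ)
    (D : V → V → Prop) (a b : V) : Prop :=
  D a b ∧ ((a ∉ X ∧ b ∈ C) ∨ (a ∈ C ∧ ¬ G.IsTight X k b ∧ f b = k + 3) ∨
    (a ∈ C ∧ G.IsTight X k b ∧ ¬ G.Loose C b ∧ ∀ x ∈ C, D x b → x = a))

/-- Arcs at whose end the surplus of an overloaded orientation can be absorbed. -/
def Absorbs (G : SimpleGraph V) (X : Set V) (k : ℕ) (C : Finset V) (f : V → ℕ)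
    (D : V → V → Prop) (a b : V) : Prop :=
  D a b ∧ ((a ∉ X ∧ ¬ G.IsTight X k a ∧ b ∉ C) ∨ (a ∈ C ∧ ¬ G.IsTight X k b ∧ f b < k + 3) ∨
    (a ∈ C ∧ G.IsTight X k b ∧ (G.Loose C b ∨ ∃ x ∈ C, x ≠ a ∧ D x b)))

variable {f : V → ℕ} {g : ℕ}

omit [Fintype V] in
theorem flipArc_in_iff (hva : v ≠ a) (hvb : v ≠ b)
    (x : V) : flipArc D a b x v ↔ D x v := by
  apply flipArc_iff_of_ne <;> tauto

/-- Moving the surplus along one arc. -/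
theorem Overloaded.pass (hX : ∀ u v, G.Adj u v → (u ∈ X ↔ v ∉ X)) (hC : ∀ x ∈ C, x ∈ X)
    (h : G.Overloaded X k C f g D a) (hab : G.Passes X k C f D a b) :
    G.Overloaded X k C f g (flipArc D a b) b := by
  obtain ⟨hDab, hab⟩ := hab
  have hO := h.orients
  have hadj := hO.adj hDab
  have hside := hX _ _ hadj
  have hne := hadj.ne
  have h1 := hO.outdeg_flipArc_tail hDab
  have h2 := hO.outdeg_flipArc_head hDab
  have h3 : ∀ v, v ≠ a → v ≠ b → outdeg (flipArc D a b) v = outdeg D v :=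
    fun v => outdeg_flipArc_of_ne
  constructor
  · exact hO.flipArc hDab
  · intro x hx
    have := h.eq_capped x hx
    by_cases hxa : x = a
    · subst hxa; simp [hne] at this ⊢; omega
    · by_cases hxb : x = b
      · subst hxb; simp [hxa] at this ⊢; omega
      · rw [h3 x hxa hxb]; simp [hxa, hxb] at this ⊢; omega
  · intro x hx hxC
    have := h.le_mem x hx hxC
    have hxa : x ≠ a := by rintro rfl; exact hxC (h.mem_imp hx)
    have hxb : x ≠ b := by
      rintro rfl
      rcases hab with hab | hab | hab
      · exact hxC hab.2
      · exact absurd (hC _ hab.1) (by tauto)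
      · exact absurd (hC _ hab.1) (by tauto)
    rwa [h3 x hxa hxb]
  · intro x hx hxt
    have := h.eq_notMem x hx hxt
    by_cases hxa : x = a
    · subst hxa; simp [hne] at this ⊢; omega
    · by_cases hxb : x = b
      · subst hxb; simp [hxa] at this ⊢; omega
      · rw [h3 x hxa hxb]; simp [hxa, hxb] at this ⊢; omega
  · intro hbX hbt
    rcases hab with hab | hab | hab
    · exact absurd (hC _ hab.2) hbX
    · exact hab.2.2
    · exact absurd hab.2.1 hbt
  · intro hbX
    rcases hab with hab | hab | hab
    · exact hab.2
    · exact absurd (hC _ hab.1) (by tauto)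
    · exact absurd (hC _ hab.1) (by tauto)
  · intro hbt
    rcases hab with hab | hab | hab
    · exact absurd (hC _ hab.2) hbt.1
    · exact absurd hbt hab.2.1
    · exact hab.2.2.1
  · intro hbt
    rcases hab with hab | hab | hab
    · exact absurd (hC _ hab.2) hbt.1
    · exact absurd hbt hab.2.1
    · intro x hx hxb
      by_cases hxa : x = a
      · subst hxa; exact hO.not_flipArc hDab hxb
      · have hxb' : x ≠ b := by rintro rfl; exact hbt.1 (hC _ hx)
        rw [flipArc_iff_of_ne (by tauto) (by tauto)] at hxb
        exact hxa (hab.2.2.2 x hx hxb)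
  · refine h.le_card.trans (card_le_card fun z hz => ?_)
    simp only [mem_filter, mem_univ, true_and] at hz ⊢
    refine ⟨hz.1, ?_⟩
    by_cases hzb : z = b
    · exact .inl hzb
    refine .inr ?_
    by_cases hza : z = a
    -- A tight vertex that hands its surplus to a capped `b` becomes good: the reversed arc enters
    -- it from `b`.
    · subst hza
      rcases hab with hab | hab | hab
      · exact .inl ⟨b, hab.2, flipArc_self _ _ _⟩
      · exact absurd (hC _ hab.1) hz.1.1
      · exact absurd (hC _ hab.1) hz.1.1
    · exact (hz.2.resolve_left hza).congr fun x => (flipArc_in_iff hza hzb x).symm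

/-- Absorbing the surplus. -/
theorem Overloaded.absorb (hX : ∀ u v, G.Adj u v → (u ∈ X ↔ v ∉ X)) (hC : ∀ x ∈ C, x ∈ X)
    (hf : ∀ v, f v ≤ k + 3)
    (h : G.Overloaded X k C f g D a) (hab : G.Absorbs X k C f D a b) :
    G.Attains X k (∑ v with v ∉ X ∧ ¬ G.IsTight X k v, (f v - (k + 1))) #C g := by
  obtain ⟨hDab, hab⟩ := hab
  have hO := h.orients
  have hadj := hO.adj hDab
  have hside := hX _ _ hadj
  have hne := hadj.ne
  have h1 := hO.outdeg_flipArc_tail hDab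
  have h2 := hO.outdeg_flipArc_head hDab
  have h3 : ∀ v, v ≠ a → v ≠ b → outdeg (flipArc D a b) v = outdeg D v :=
    fun v => outdeg_flipArc_of_ne
  have hbC : b ∉ C := by
    rcases hab with hab | hab | hab
    · exact hab.2.2
    · intro hb; have := hC _ hb; have := hC _ hab.1; tauto
    · intro hb; have := hC _ hb; have := hC _ hab.1; tauto
  have haZ : ¬ G.IsTight X k a := by
    rcases hab with hab | hab | hab
    · exact hab.2.1
    · exact fun ha => ha.1 (hC _ hab.1)
    · exact fun ha => ha.1 (hC _ hab.1)
  have hcap : ∀ x ∈ C, outdeg (flipArc D a b) x = k + 2 := by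
    intro x hx
    have := h.eq_capped x hx
    have hxb : x ≠ b := by rintro rfl; exact hbC hx
    by_cases hxa : x = a
    · subst hxa; simp at this; omega
    · rw [h3 x hxa hxb]; simpa [hxa] using this
  have hfree : ∀ x ∈ X, x ∉ C → x ≠ b → outdeg (flipArc D a b) x ≤ k + 1 := by
    intro x hx hxC hxb
    have hxa : x ≠ a := by rintro rfl; exact hxC (h.mem_imp hx)
    rw [h3 x hxa hxb]; exact h.le_mem x hx hxC
  have hY : ∀ y, y ∉ X → ¬ G.IsTight X k y → y ≠ b → outdeg (flipArc D a b) y = f y := by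
    intro y hy hyt hyb
    have := h.eq_notMem y hy hyt
    by_cases hya : y = a
    · subst hya; simp at this; omega
    · rw [h3 y hya hyb]; simpa [hya] using this
  have hYb : b ∉ X → ¬ G.IsTight X k b → outdeg (flipArc D a b) b = f b + 1 ∧ f b < k + 3 := by
    intro hbX hbt
    have := h.eq_notMem b hbX hbt
    simp [hne.symm] at this
    rcases hab with hab | hab | hab
    · tauto
    · omega
    · exact absurd hab.2.1 hbt
  have hO' := hO.flipArc hDab
  have hsub : C ⊆ capped X k (flipArc D a b) := fun x hx => mem_capped.2 ⟨hC x hx, hcap x hx⟩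
  have hA : G.Admissible X k (flipArc D a b) := by
    refine ⟨hO', fun x hx => ?_, fun y hy => ?_⟩
    · by_cases hxC : x ∈ C
      · exact (hcap x hxC).le
      · by_cases hxb : x = b
        · subst hxb; have := h.le_mem x hx hxC; omega
        · exact (hfree x hx hxC hxb).trans (by omega)
    · by_cases hyt : G.IsTight X k y
      · have := hO'.outdeg_add_indeg y
        have := hyt.2
        omega
      · by_cases hyb : y = b
        · subst hyb; have := hYb hy hyt; omega
        · rw [hY y hy hyt hyb]; exact hf y
  have hE : ∑ v with v ∉ X ∧ ¬ G.IsTight X k v, (f v - (k + 1)) ≤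
      G.excess X k (flipArc D a b) := by
    refine sum_le_sum fun y hy => ?_
    simp only [mem_filter, mem_univ, true_and] at hy
    by_cases hyb : y = b
    · subst hyb; have := hYb hy.1 hy.2; omega
    · rw [hY y hy.1 hy.2 hyb]
  by_cases hbX : b ∈ X
  -- If `b` becomes capped, the number of capped vertices grows and good vertices need not be
  -- tracked.
  · by_cases hbk : outdeg (flipArc D a b) b = k + 2
    · exact ⟨_, hA, hE, .inl (card_lt_card ⟨hsub, fun h => hbC (h (mem_capped.2 ⟨hbX, hbk⟩))⟩)⟩
    refine ⟨_, hA, hE, .inr ⟨card_le_card hsub, h.le_card.trans (card_le_card fun z hz => ?_)⟩⟩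
    have hCe : capped X k (flipArc D a b) = C := by
      refine Subset.antisymm (fun x hx => ?_) hsub
      rw [mem_capped] at hx
      by_contra hxC
      have hxb : x ≠ b := by rintro rfl; exact hbk hx.2
      have := hfree x hx.1 hxC hxb
      omega
    simp only [mem_filter, mem_univ, true_and] at hz ⊢
    have hza : z ≠ a := by rintro rfl; exact haZ hz.1
    have hzb : z ≠ b := by rintro rfl; exact hz.1.1 hbX
    rw [hCe]
    exact ⟨hz.1, (hz.2.resolve_left hza).congr fun x => (flipArc_in_iff hza hzb x).symm⟩
  · have hCe : capped X k (flipArc D a b) = C := by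
      refine Subset.antisymm (fun x hx => ?_) hsub
      rw [mem_capped] at hx
      by_contra hxC
      have hxb : x ≠ b := by rintro rfl; exact hbX hx.1
      have := hfree x hx.1 hxC hxb
      omega
    have hcard : g ≤ #{y | G.IsTight X k y ∧
        (y = b ∨ G.Good (capped X k (flipArc D a b)) (flipArc D a b) y)} := by
      refine h.le_card.trans (card_le_card fun z hz => ?_)
      simp only [mem_filter, mem_univ, true_and] at hz ⊢
      refine ⟨hz.1, ?_⟩
      have hza : z ≠ a := by rintro rfl; exact haZ hz.1
      by_cases hzb : z = b
      · exact .inl hzb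
      rw [hCe]
      exact .inr ((hz.2.resolve_left hza).congr fun x => (flipArc_in_iff hza hzb x).symm)
    by_cases hbt : G.IsTight X k b
    · by_cases hl : G.Loose C b
      -- The reversal takes the in-neighbour `a` away from `b`; looseness makes `b` good again.
      · obtain ⟨D', h1, h2, h3⟩ := attains_of_loose hX hA hbt (by rwa [hCe])
        have := card_le_card hsub
        exact ⟨D', h1, hE.trans h2, by omega⟩
      · refine ⟨_, hA, hE, .inr ⟨card_le_card hsub, hcard.trans (card_le_card fun z hz => ?_)⟩⟩
        simp only [mem_filter, mem_univ, true_and] at hz ⊢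
        refine ⟨hz.1, ?_⟩
        obtain ⟨-, rfl | hz⟩ := hz
        · obtain ⟨x, hxC, hxa, hxz⟩ : ∃ x ∈ C, x ≠ a ∧ D x z := by
            rcases hab with hab | hab | hab
            · exact absurd hab.2.1 (by tauto)
            · exact absurd hbt hab.2.1
            · exact hab.2.2.resolve_left hl
          refine .inl ⟨x, hsub hxC, ?_⟩
          rw [flipArc_iff_of_ne (by tauto) (by rintro ⟨rfl, -⟩; exact hbC hxC)]
          exact hxz
        · exact hz
    · refine ⟨_, hA, hE, .inr ⟨card_le_card hsub, hcard.trans (card_le_card fun z hz => ?_)⟩⟩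
      simp only [mem_filter, mem_univ, true_and] at hz ⊢
      exact ⟨hz.1, hz.2.resolve_left (by rintro rfl; exact hbt hz.1)⟩

end States

/-! ### Tight vertices can be made good, by density -/

section Shedding

open scoped Classical

variable {V : Type*} [Fintype V] {G : SimpleGraph V} {X : Set V} {k : ℕ} {D D₀ : V → V → Prop}
  {C : Finset V} {f : V → ℕ} {g : ℕ} {a b u v w x y z : V}

/-- Whether an arc passes or absorbs depends only on the arcs entering its head. After shortcuts the
walk returns to neither end of its first arc, so reversing that arc leaves the rest of the walk
usable. -/
theorem Overloaded.attains_of_walk (hX : ∀ u v, G.Adj u v → (u ∈ X ↔ v ∉ X)) (hC : ∀ x ∈ C, x ∈ X)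
    (hf : ∀ v, f v ≤ k + 3) (n : ℕ) : ∀ (D : V → V → Prop) (v b : V) (p : ℕ → V),
    G.Overloaded X k C f g D v → p 0 = v → (∀ i < n, G.Passes X k C f D (p i) (p (i + 1))) →
    G.Absorbs X k C f D (p n) b →
    G.Attains X k (∑ v with v ∉ X ∧ ¬ G.IsTight X k v, (f v - (k + 1))) #C g := by
  induction n using Nat.strong_induction_on with
  | _ n ih =>
  intro D v b p h hp hstep hend
  rcases n with _ | n
  · subst hp; exact h.absorb hX hC hf hend
  by_cases h0 : ∃ i, 0 < i ∧ i ≤ n + 1 ∧ p i = v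
  · obtain ⟨i, hi0, hin, hi⟩ := h0
    refine ih (n + 1 - i) (by omega) D v b (fun j => p (j + i)) h (by simpa using hi) ?_ ?_
    · intro j hj
      have := hstep (j + i) (by omega)
      rwa [show j + i + 1 = j + 1 + i by omega] at this
    · simpa [hin] using hend
  by_cases h1 : ∃ i, 2 ≤ i ∧ i ≤ n + 1 ∧ p i = p 1
  · obtain ⟨i, hi0, hin, hi⟩ := h1
    refine ih (n + 2 - i) (by omega) D v b (fun j => if j = 0 then v else p (j + (i - 1))) h
      (by simp) ?_ ?_
    · intro j hj
      by_cases hj0 : j = 0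
      · subst hj0
        have := hstep 0 (by omega)
        simp only [zero_add, one_ne_zero, if_true, if_false] at this ⊢
        rwa [show 1 + (i - 1) = i by omega, hi, ← hp]
      · have := hstep (j + (i - 1)) (by omega)
        simp only [hj0, if_false, Nat.add_eq_zero_iff, one_ne_zero, and_false]
        rwa [show j + 1 + (i - 1) = j + (i - 1) + 1 by omega]
    · simp only [show n + 2 - i ≠ 0 by omega, if_false]
      rwa [show n + 2 - i + (i - 1) = n + 1 by omega]
  push Not at h0 h1
  have hO := h.orients
  have h01 : G.Passes X k C f D v (p 1) := by
    have := hstep 0 (by omega)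
    rwa [hp] at this
  have hin : ∀ y, y ≠ v → y ≠ p 1 → ∀ x, flipArc D v (p 1) x y ↔ D x y :=
    fun y h2 h3 x => flipArc_in_iff h2 h3 x
  refine ih n (by omega) (flipArc D v (p 1)) (p 1) b (fun j => p (j + 1))
    (h.pass hX hC h01) rfl ?_ ?_
  · intro i hi
    have hs := hstep (i + 1) (by omega)
    have e := hin _ (h0 (i + 2) (by omega) (by omega)) (h1 (i + 2) (by omega) (by omega))
    unfold Passes at hs ⊢
    simpa only [e] using hs
  -- The final head `b` is neither end of the reversed arc either: the conditions under which a
  -- vertex holds or receives the surplus exclude absorption there.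
  · have hadj := hO.adj hend.1
    have hside := hX _ _ hadj
    have hpv := h0 (n + 1) (by omega) le_rfl
    have hbv : b ≠ v := by
      rintro rfl
      obtain ⟨hD, h2 | h2 | h2⟩ := hend
      · exact h2.2.2 (h.mem_imp (by tauto))
      · have := h.notMem_eq (fun hb => by have := hC _ h2.1; tauto) h2.2.1
        omega
      · exact h.no_source h2.2.1 _ h2.1 hD
    have hb1 : b ≠ p 1 := by
      rintro rfl
      obtain ⟨h01, h3⟩ := h01
      have hn : p (n + 1) ≠ v := hpv
      obtain ⟨hD, h2 | h2 | h2⟩ := hend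
      · rcases h3 with h3 | h3 | h3
        · exact h2.2.2 h3.2
        · have := hX _ _ (hO.adj h01); have := hC _ h3.1; tauto
        · exact h3.2.1.1 (by tauto)
      · rcases h3 with h3 | h3 | h3
        · have := hC _ h2.1; have := hC _ h3.2; tauto
        · omega
        · exact h2.2.1 h3.2.1
      · rcases h3 with h3 | h3 | h3
        · exact h2.2.1.1 (hC _ h3.2)
        · exact h3.2.1 h2.2.1
        · exact hn (h3.2.2.2 _ h2.1 hD)
    have e := hin _ hbv hb1
    unfold Absorbs at hend ⊢
    simpa only [e] using hend

/-- A tight vertex that is not good can be repaired, unless the graph is too dense. -/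
theorem attains_of_not_good (hX : ∀ u v, G.Adj u v → (u ∈ X ↔ v ∉ X)) (h₀ : G.Orients D₀)
    (hk : ∀ v, outdeg D₀ v ≤ k) (hD : G.Admissible X k D)
    (hz : G.IsTight X k z) (hg : ¬ G.Good (capped X k D) D z) :
    G.Attains X k (G.excess X k D) #(capped X k D) (G.numGood X k D + 1) := by
  have hcard : G.numGood X k D + 1 ≤
      #{y | G.IsTight X k y ∧ (y = z ∨ G.Good (capped X k D) D y)} := by
    rw [Nat.add_one_le_iff]
    refine card_lt_card ⟨fun y hy => ?_, fun hs => ?_⟩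
    · simp only [mem_filter, mem_univ, true_and] at hy ⊢; tauto
    · have := @hs z (by simp [hz])
      simp only [mem_filter, mem_univ, true_and] at this; tauto
  by_cases hl : G.Loose (capped X k D) z
  · obtain ⟨D', h1, h2, h3⟩ := attains_of_loose hX hD hz hl
    exact ⟨D', h1, h2, by omega⟩
  have hO := hD.orients
  have hC : ∀ x ∈ capped X k D, x ∈ X := fun x hx => (mem_capped.1 hx).1
  set C := capped X k D with hCdef
  by_cases hex : ∃ u b, (∃ (n : ℕ) (p : ℕ → V), p 0 = z ∧
      (∀ i < n, G.Passes X k C (outdeg D) D (p i) (p (i + 1))) ∧ p n = u) ∧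
      G.Absorbs X k C (outdeg D) D u b
  · obtain ⟨u, b, ⟨n, p, hp0, hp, rfl⟩, hb⟩ := hex
    have hf : ∀ v, outdeg D v ≤ k + 3 := by
      intro v
      by_cases hv : v ∈ X
      · exact (hD.le_mem v hv).trans (by omega)
      · exact hD.le_notMem v hv
    refine Overloaded.attains_of_walk hX hC hf n D z b p ?_ hp0 hp hb
    refine ⟨hO, fun x hx => ?_, fun x hx hxC => ?_, fun y hy hyt => ?_, fun _ h => absurd hz h,
      fun h => absurd h hz.1, fun _ => hl, fun _ x hx hxz => hg (.inl ⟨x, hx, hxz⟩), hcard⟩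
    · have : x ≠ z := by rintro rfl; exact hz.1 (hC x hx)
      simp [this, (mem_capped.1 hx).2]
    · have := hD.le_mem x hx
      have : outdeg D x ≠ k + 2 := fun h => hxC (mem_capped.2 ⟨hx, h⟩)
      omega
    · have : y ≠ z := by rintro rfl; exact hyt hz
      simp [this]
  exfalso
  push Not at hex
  -- All vertices the surplus can reach; by assumption it can be absorbed at none of them.
  set R : Finset V := {u | ∃ (n : ℕ) (p : ℕ → V), p 0 = z ∧
      (∀ i < n, G.Passes X k C (outdeg D) D (p i) (p (i + 1))) ∧ p n = u} with hR
  have hzR : z ∈ R := by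
    simp only [hR, mem_filter, mem_univ, true_and]
    exact ⟨0, fun _ => z, rfl, by simp, rfl⟩
  have hclosed : ∀ u ∈ R, ∀ b, G.Passes X k C (outdeg D) D u b → b ∈ R := by
    intro u hu b hub
    simp only [hR, mem_filter, mem_univ, true_and] at hu ⊢
    obtain ⟨n, p, hp0, hp, rfl⟩ := hu
    refine ⟨n + 1, fun j => if j ≤ n then p j else b, by simpa using hp0, fun i hi => ?_, by simp⟩
    by_cases hin : i = n
    · subst hin; simpa using hub
    · simpa [show i ≤ n by omega, show i + 1 ≤ n by omega] using hp i (by omega)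
  have hno : ∀ u ∈ R, ∀ b, ¬ G.Absorbs X k C (outdeg D) D u b := by
    intro u hu b
    simp only [hR, mem_filter, mem_univ, true_and] at hu
    exact hex u b hu
  have hkind : ∀ u ∈ R, u = z ∨ u ∈ C ∨ (u ∉ X ∧ ¬ G.IsTight X k u ∧ outdeg D u = k + 3) ∨
      (G.IsTight X k u ∧ ¬ G.Loose C u ∧ #{x ∈ C | D x u} ≤ 1) := by
    intro u hu
    simp only [hR, mem_filter, mem_univ, true_and] at hu
    obtain ⟨n, p, hp0, hp, rfl⟩ := hu
    rcases n with _ | n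
    · exact .inl hp0
    obtain ⟨hd, h1 | h1 | h1⟩ := hp n (by omega)
    · exact .inr (.inl h1.2)
    · have := hX _ _ (hO.adj hd)
      have := hC _ h1.1
      exact .inr (.inr (.inl ⟨by tauto, h1.2⟩))
    · refine .inr (.inr (.inr ⟨h1.2.1, h1.2.2.1, ?_⟩))
      rw [card_le_one]
      intro x hx y hy
      simp only [mem_filter] at hx hy
      rw [h1.2.2.2 x hx.1 hx.2, h1.2.2.2 y hy.1 hy.2]
  have htight : ∀ u, G.IsTight X k u → ¬ G.Loose C u →
      k + 1 ≤ #{x ∈ C | D x u} + #{x ∈ C | D u x} := by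
    intro u hu hlu
    have h1 : G.deg u ≤ #{x | G.Adj u x ∧ x ∉ C} + (#{x ∈ C | D x u} + #{x ∈ C | D u x}) := by
      refine le_trans (card_le_card ?_) ((card_union_le _ _).trans
        (Nat.add_le_add_left (card_union_le _ _) _))
      intro x hx
      simp only [mem_filter, mem_univ, true_and, mem_union] at hx ⊢
      have := hO.adj_iff u x
      tauto
    have h2 := hu.2
    unfold Loose at hlu
    omega
  have htin : ∀ u ∈ R, G.IsTight X k u → #{x ∈ C | D u x} ≤ #{w ∈ R | D u w} := by
    intro u hu hut
    refine card_le_card fun x hx => ?_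
    simp only [mem_filter] at hx ⊢
    exact ⟨hclosed u hu x ⟨hx.2, .inl ⟨hut.1, hx.1⟩⟩, hx.2⟩
  have hzout : k + 1 ≤ #{w ∈ R | D z w} := by
    have h1 := htight z hz hl
    have h2 := htin z hzR hz
    have h3 : #{x ∈ C | D x z} = 0 := by
      rw [card_eq_zero, filter_eq_empty_iff]
      exact fun x hx hxz => hg (.inl ⟨x, hx, hxz⟩)
    omega
  -- Capped vertices, and non-tight ones of outdegree `k + 3`, keep all their arcs in `R`. A tight
  -- vertex that is not loose has at least `k + 1` capped neighbours, at most one of them an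
  -- in-neighbour. For `z` there is none, which makes the final inequality strict.
  have hout : ∀ u ∈ R, k ≤ #{w ∈ R | D u w} := by
    intro u hu
    have hall : (∀ b, D u b → b ∈ R) → outdeg D u ≤ #{w ∈ R | D u w} := by
      intro h
      refine card_le_card fun x hx => ?_
      simp only [mem_filter, mem_univ, true_and] at hx ⊢
      exact ⟨h x hx, hx⟩
    rcases hkind u hu with rfl | h1 | h1 | h1
    · omega
    · have h2 := hall fun b hb => by
        have hbX : b ∉ X := (hX _ _ (hO.adj hb)).1 (hC u h1)
        refine hclosed u hu b ⟨hb, ?_⟩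
        have h4 := hD.le_notMem b hbX
        by_cases hbt : G.IsTight X k b
        · have h5 : ∀ x ∈ C, D x b → x = u := by
            intro x hx hxb
            by_contra hne
            exact hno u hu b ⟨hb, .inr (.inr ⟨h1, hbt, .inr ⟨x, hx, hne, hxb⟩⟩)⟩
          exact .inr (.inr ⟨h1, hbt, fun hlb =>
            hno u hu b ⟨hb, .inr (.inr ⟨h1, hbt, .inl hlb⟩)⟩, h5⟩)
        · have h5 : ¬ outdeg D b < k + 3 := fun hlt =>
            hno u hu b ⟨hb, .inr (.inl ⟨h1, hbt, hlt⟩)⟩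
          exact .inr (.inl ⟨h1, hbt, by omega⟩)
      have := (mem_capped.1 h1).2
      omega
    · have h2 := hall fun b hb => by
        refine hclosed u hu b ⟨hb, .inl ⟨h1.1, ?_⟩⟩
        by_contra hbC
        exact hno u hu b ⟨hb, .inl ⟨h1.1, h1.2.1, hbC⟩⟩
      omega
    · have := htight u h1.1 h1.2.1
      have := htin u hu h1.1
      omega
  have hsum := hO.sum_card_inside_le h₀ hk R
  have : k * #R < ∑ u ∈ R, #{w ∈ R | D u w} := by
    rw [mul_comm, ← smul_eq_mul, ← sum_const]
    exact sum_lt_sum hout ⟨z, hzR, by omega⟩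
  omega

end Shedding

/-! ### Extremal orientations and their remaining conflicts -/

section Optimal

open scoped Classical

variable {V : Type*} [Fintype V]

/-- A tight vertex without capped in-neighbours. -/
def Slack (G : SimpleGraph V) (X : Set V) (k : ℕ) (D : V → V → Prop) (z : V) : Prop :=
  G.IsTight X k z ∧ ∀ x ∈ capped X k D, ¬ D x z

/-- The vertices outside `X` that are not slack. -/
def Normal (G : SimpleGraph V) (X : Set V) (k : ℕ) (D : V → V → Prop) (y : V) : Prop :=
  y ∉ X ∧ ¬ G.Slack X k D y

/-- The number of normal vertices of outdegree at least `k + 1`. -/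
noncomputable def numHigh (G : SimpleGraph V) (X : Set V) (k : ℕ) (D : V → V → Prop) : ℕ :=
  #{y | G.Normal X k D y ∧ k + 1 ≤ outdeg D y}

/-- The number of arcs to normal vertices from vertices in `X` of outdegree at least `k`. -/
noncomputable def numArcs (G : SimpleGraph V) (X : Set V) (k : ℕ) (D : V → V → Prop) : ℕ :=
  #{p : V × V | (p.1 ∈ X ∧ k ≤ outdeg D p.1) ∧ D p.1 p.2 ∧ G.Normal X k D p.2}

/-- The contribution of a vertex to the last component of the potential. -/
noncomputable def weight (G : SimpleGraph V) (X : Set V) (k : ℕ) (D : V → V → Prop) (v : V) : ℕ :=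
  if v ∈ X then min (outdeg D v) k ^ 2 else if G.Normal X k D v then outdeg D v ^ 2 else 0

/-- The potential of an orientation, to be maximised lexicographically. -/
noncomputable def potential (G : SimpleGraph V) (X : Set V) (k : ℕ) (D : V → V → Prop) :
    ℕ ×ₗ ℕ ×ₗ ℕ ×ₗ ℕ ×ₗ ℕ ×ₗ ℕ :=
  toLex (G.excess X k D, toLex (#(capped X k D), toLex (G.numGood X k D,
    toLex (G.numHigh X k D, toLex (G.numArcs X k D, ∑ v, G.weight X k D v)))))

/-- The admissible orientations of maximal potential. -/
structure Optimal (G : SimpleGraph V) (X : Set V) (k : ℕ) (D : V → V → Prop) : Prop where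
  admissible : G.Admissible X k D
  le : ∀ D', G.Admissible X k D' → G.potential X k D' ≤ G.potential X k D

variable {G : SimpleGraph V} {X : Set V} {k : ℕ} {D D' D₀ : V → V → Prop}
  {a b u v w w' x y z : V}

theorem exists_optimal (h : G.Admissible X k D) : ∃ D, G.Optimal X k D := by
  obtain ⟨D', h1, h2⟩ := Set.exists_max_image {D | G.Admissible X k D} (G.potential X k)
    (Set.toFinite _) ⟨D, h⟩
  exact ⟨D', h1, h2⟩

theorem Optimal.compare (h : G.Optimal X k D) (h' : G.Admissible X k D') :
    G.excess X k D' < G.excess X k D ∨ G.excess X k D' = G.excess X k D ∧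
    (#(capped X k D') < #(capped X k D) ∨ #(capped X k D') = #(capped X k D) ∧
    (G.numGood X k D' < G.numGood X k D ∨ G.numGood X k D' = G.numGood X k D ∧
    (G.numHigh X k D' < G.numHigh X k D ∨ G.numHigh X k D' = G.numHigh X k D ∧
    (G.numArcs X k D' < G.numArcs X k D ∨ G.numArcs X k D' = G.numArcs X k D ∧
    ∑ v, G.weight X k D' v ≤ ∑ v, G.weight X k D v)))) := by
  have := h.le D' h'
  simpa only [potential, Prod.Lex.toLex_le_toLex] using this

theorem Optimal.of_eq (h : G.Optimal X k D) (h' : G.Admissible X k D')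
    (he : G.potential X k D' = G.potential X k D) : G.Optimal X k D' :=
  ⟨h', fun D'' h'' => he ▸ h.le D'' h''⟩

theorem Slack.loose_and_indeg (hz : G.Slack X k D z) (hg : G.Good (capped X k D) D z) :
    G.Loose (capped X k D) z ∧ indeg D z = 1 :=
  hg.resolve_left fun ⟨x, hx, hxz⟩ => hz.2 x hx hxz

theorem eq_of_indeg_eq_one (h : indeg D z = 1) (hx : D x z) (hy : D y z) : x = y := by
  unfold indeg at h
  exact card_le_one.1 h.le x (by simpa using hx) y (by simpa using hy)

/-- The capped vertices and the arcs leaving them are the same, and so are the indegrees of slack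
vertices. -/
structure Similar (G : SimpleGraph V) (X : Set V) (k : ℕ) (D D' : V → V → Prop) : Prop where
  capped_eq : capped X k D' = capped X k D
  arc_iff : ∀ x ∈ capped X k D, ∀ y, D' x y ↔ D x y
  indeg_eq : ∀ z, G.Slack X k D z → indeg D' z = indeg D z

theorem Similar.slack_iff (h : G.Similar X k D D') : G.Slack X k D' z ↔ G.Slack X k D z := by
  unfold Slack
  rw [h.capped_eq]
  exact and_congr_right fun _ => forall₂_congr fun x hx => not_congr (h.arc_iff x hx z)

theorem Similar.normal_iff (h : G.Similar X k D D') : G.Normal X k D' z ↔ G.Normal X k D z := by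
  unfold Normal; rw [h.slack_iff]

theorem Similar.numGood_eq (h : G.Similar X k D D') : G.numGood X k D' = G.numGood X k D := by
  unfold numGood
  congr 1
  refine filter_congr fun z _ => and_congr_right fun hz => ?_
  unfold Good
  rw [h.capped_eq]
  have e : (∃ x ∈ capped X k D, D' x z) ↔ ∃ x ∈ capped X k D, D x z :=
    exists_congr fun x => and_congr_right fun hx => h.arc_iff x hx z
  rw [e]
  by_cases hf : ∃ x ∈ capped X k D, D x z
  · simp [hf]
  · rw [h.indeg_eq z ⟨hz, fun x hx hxz => hf ⟨x, hx, hxz⟩⟩]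

theorem excess_eq (h : ∀ y, y ∉ X → ¬ G.IsTight X k y →
    outdeg D' y - (k + 1) = outdeg D y - (k + 1)) : G.excess X k D' = G.excess X k D := by
  refine sum_congr rfl fun y hy => ?_
  simp only [mem_filter, mem_univ, true_and] at hy
  exact h y hy.1 hy.2

theorem Similar.numHigh_eq (h : G.Similar X k D D')
    (h' : ∀ y, G.Normal X k D y → (k + 1 ≤ outdeg D' y ↔ k + 1 ≤ outdeg D y)) :
    G.numHigh X k D' = G.numHigh X k D := by
  unfold numHigh
  congr 1
  refine filter_congr fun y _ => ?_
  rw [h.normal_iff]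
  exact and_congr_right (h' y)

theorem Similar.numArcs_le (h : G.Similar X k D D')
    (h' : ∀ x ∈ X, k ≤ outdeg D x → k ≤ outdeg D' x)
    (h'' : ∀ x ∈ X, k ≤ outdeg D x → ∀ y, G.Normal X k D y → D x y → D' x y) :
    G.numArcs X k D ≤ G.numArcs X k D' := by
  refine card_le_card fun p hp => ?_
  simp only [mem_filter, mem_univ, true_and] at hp ⊢
  exact ⟨⟨hp.1.1, h' _ hp.1.1 hp.1.2⟩, h'' _ hp.1.1 hp.1.2 _ hp.2.2 hp.2.1, h.normal_iff.2 hp.2.2⟩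

/-- Reversing an arc preserves admissibility if its head has room for one more arc. -/
theorem Admissible.flipArc (hD : G.Admissible X k D)
    (hab : D a b) (hb : b ∈ X → outdeg D b ≤ k + 1)
    (hb' : b ∉ X → outdeg D b ≤ k + 2) : G.Admissible X k (flipArc D a b) := by
  have hO := hD.orients
  have h1 := hO.outdeg_flipArc_tail hab
  have h2 := hO.outdeg_flipArc_head hab
  refine ⟨hO.flipArc hab, fun x hx => ?_, fun y hy => ?_⟩
  · by_cases hxb : x = b
    · subst hxb; have := hb hx; omega
    by_cases hxa : x = a
    · subst hxa; have := hD.le_mem x hx; omega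
    rw [outdeg_flipArc_of_ne hxa hxb]; exact hD.le_mem x hx
  · by_cases hyb : y = b
    · subst hyb; have := hb' hy; omega
    by_cases hya : y = a
    · subst hya; have := hD.le_notMem y hy; omega
    rw [outdeg_flipArc_of_ne hya hyb]; exact hD.le_notMem y hy

section

variable (hX : ∀ u v, G.Adj u v → (u ∈ X ↔ v ∉ X)) (hD : G.Optimal X k D)

include hX hD

theorem Optimal.good (h₀ : G.Orients D₀) (hk : ∀ v, outdeg D₀ v ≤ k) (hz : G.IsTight X k z) :
    G.Good (capped X k D) D z := by
  by_contra hg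
  obtain ⟨D', h1, h2, h3⟩ := attains_of_not_good hX h₀ hk hD.admissible hz hg
  have := hD.compare h1
  omega

/-- Reversing an arc into `y` would raise the excess, to which its tail in `X` does not contribute.
So such a `y` is a source. -/
theorem Optimal.not_arc_of_excess (hy : y ∉ X) (hyt : ¬ G.IsTight X k y) (h1 : k + 1 ≤ outdeg D y)
    (h2 : outdeg D y ≤ k + 2) : ¬ D x y := by
  intro hxy
  have hO := hD.admissible.orients
  have hxX : x ∈ X := by have := hX _ _ (hO.adj hxy); tauto
  have hA := hD.admissible.flipArc hxy (fun h => absurd h hy) (fun _ => h2)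
  have hlt : G.excess X k D < G.excess X k (flipArc D x y) := by
    have h3 := hO.outdeg_flipArc_head hxy
    refine sum_lt_sum (fun v hv => ?_) ⟨y, by simp [hy, hyt], by omega⟩
    simp only [mem_filter, mem_univ, true_and] at hv
    by_cases hvy : v = y
    · subst hvy; omega
    · rw [outdeg_flipArc_of_ne (by rintro rfl; exact hv.1 hxX) hvy]
  have := hD.compare hA
  omega

/-- The reversal would make `x` capped. It costs no excess, since tight vertices are not counted and
outdegrees up to `k + 1` contribute zero. -/
theorem Optimal.not_arc_to_mem (hx : x ∈ X) (hxk : outdeg D x = k + 1)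
    (hy : G.IsTight X k y ∨ outdeg D y ≤ k + 1) : ¬ D y x := by
  intro hyx
  have hO := hD.admissible.orients
  have hyX : y ∉ X := by have := hX _ _ (hO.adj hyx); tauto
  have hA := hD.admissible.flipArc hyx (fun _ => hxk.le) (fun h => absurd hx h)
  have h1 := hO.outdeg_flipArc_tail hyx
  have h2 := hO.outdeg_flipArc_head hyx
  have he : G.excess X k (flipArc D y x) = G.excess X k D := by
    refine excess_eq fun v hv hvt => ?_
    by_cases hvy : v = y
    · subst hvy; have := hy.resolve_left hvt; omega
    · rw [outdeg_flipArc_of_ne hvy (by rintro rfl; exact hv hx)]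
  have hc : #(capped X k D) < #(capped X k (flipArc D y x)) := by
    refine card_lt_card ⟨fun v hv => ?_, fun hs => ?_⟩
    · rw [mem_capped] at hv ⊢
      rw [outdeg_flipArc_of_ne (by rintro rfl; exact hyX hv.1) (by rintro rfl; omega)]
      exact hv
    · have := mem_capped.1 (hs (mem_capped.2 ⟨hx, by omega⟩))
      omega
  have := hD.compare hA
  omega

omit hX in
-- With outdegree at most `k`, `x` is capped neither before nor after, and since `y` is not slack,
-- no arc at a slack vertex changes.
theorem similar_flipArc (hab : D a b) (hx : x ∈ X) (hxk : outdeg D x ≤ k) (hy : G.Normal X k D y)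
    (h : a = x ∧ b = y ∨ a = y ∧ b = x) : G.Similar X k D (flipArc D a b) := by
  have hO := hD.admissible.orients
  have hne : x ≠ y := by rintro rfl; exact hy.1 hx
  have h1 := hO.outdeg_flipArc_tail hab
  have h2 := hO.outdeg_flipArc_head hab
  refine ⟨?_, fun v hv u => ?_, fun z hz => ?_⟩
  · ext v
    rw [mem_capped, mem_capped]
    refine and_congr_right fun hv => ?_
    have hvy : v ≠ y := by rintro rfl; exact hy.1 hv
    by_cases hvx : v = x
    · subst hvx
      obtain ⟨rfl, rfl⟩ | ⟨rfl, rfl⟩ := h <;> omega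
    · rw [outdeg_flipArc_of_ne] <;> rcases h with ⟨rfl, rfl⟩ | ⟨rfl, rfl⟩ <;> assumption
  · rw [mem_capped] at hv
    have hvy : v ≠ y := by rintro rfl; exact hy.1 hv.1
    have hvx : v ≠ x := by rintro rfl; omega
    apply flipArc_iff_of_ne <;> rcases h with ⟨rfl, rfl⟩ | ⟨rfl, rfl⟩ <;> tauto
  · have hzy : z ≠ y := by rintro rfl; exact hy.2 hz
    have hzx : z ≠ x := by rintro rfl; exact hz.1.1 hx
    refine indeg_congr fun v => ?_
    apply flipArc_iff_of_ne <;> rcases h with ⟨rfl, rfl⟩ | ⟨rfl, rfl⟩ <;> tauto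

/-- The only adjacent vertices of equal outdegree in an optimal orientation. -/
theorem Optimal.of_outdeg_eq (h₀ : G.Orients D₀) (hk : ∀ v, outdeg D₀ v ≤ k)
    (hx : x ∈ X) (hxy : G.Adj x y) (heq : outdeg D x = outdeg D y) :
    outdeg D x = k + 1 ∧ D x y ∧ G.Slack X k D y := by
  have hA := hD.admissible
  have hO := hA.orients
  have hyX : y ∉ X := (hX _ _ hxy).1 hx
  have hdeg := hO.outdeg_add_indeg y
  have hne := hxy.ne
  have hxk := hA.le_mem x hx
  -- At the value `k + 2`, a tight `y` would be a source and hence not good; any other `y` would be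
  -- a source of degree `k + 2` and hence tight.
  by_cases hx2 : outdeg D x = k + 2
  · exfalso
    by_cases hyt : G.IsTight X k y
    · have h0 : indeg D y = 0 := by have := hyt.2; omega
      unfold indeg at h0
      rw [card_eq_zero, filter_eq_empty_iff] at h0
      rcases hD.good hX h₀ hk hyt with ⟨u, -, hu⟩ | ⟨-, hu⟩
      · exact h0 (mem_univ u) hu
      · have := hyt.2; omega
    · have h0 : indeg D y = 0 := by
        unfold indeg
        rw [card_eq_zero, filter_eq_empty_iff]
        exact fun u _ => hD.not_arc_of_excess hX hyX hyt (by omega) (by omega)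
      exact hyt ⟨hyX, by omega⟩
  by_cases hx1 : outdeg D x = k + 1
  · have h1 : ¬ D y x := hD.not_arc_to_mem hX hx hx1 (.inr (by omega))
    have h2 : D x y := ((hO.adj_iff x y).1 hxy).resolve_right h1
    refine ⟨hx1, h2, ?_⟩
    have hyt : G.IsTight X k y := by
      by_contra hyt
      exact hD.not_arc_of_excess hX hyX hyt (by omega) (by omega) h2
    refine ⟨hyt, fun u hu huy => ?_⟩
    have : indeg D y = 1 := by have := hyt.2; omega
    have := eq_of_indeg_eq_one this huy h2
    subst this
    have := (mem_capped.1 hu).2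
    omega
  exfalso
  have hxk : outdeg D x ≤ k := by omega
  -- A slack vertex has degree `k + 2` and indegree one, so its outdegree is `k + 1`.
  have hy : G.Normal X k D y := by
    refine ⟨hyX, fun hs => ?_⟩
    have h1 := (hs.loose_and_indeg (hD.good hX h₀ hk hs.1)).2
    have h2 := hs.1.2
    omega
  obtain ⟨a, b, hab, hor⟩ : ∃ a b, D a b ∧ (a = x ∧ b = y ∨ a = y ∧ b = x) := by
    rcases (hO.adj_iff x y).1 hxy with h | h
    · exact ⟨x, y, h, by simp⟩
    · exact ⟨y, x, h, by simp⟩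
  have hS := similar_flipArc hD hab hx hxk hy hor
  have h1 := hO.outdeg_flipArc_tail hab
  have h2 := hO.outdeg_flipArc_head hab
  have h3 : ∀ v, v ≠ x → v ≠ y → outdeg (flipArc D a b) v = outdeg D v := by
    intro v hvx hvy
    rw [outdeg_flipArc_of_ne] <;> rcases hor with ⟨rfl, rfl⟩ | ⟨rfl, rfl⟩ <;> assumption
  have hA' : G.Admissible X k (flipArc D a b) := by
    refine hA.flipArc hab (fun hb => ?_) (fun hb => ?_) <;>
      rcases hor with ⟨rfl, rfl⟩ | ⟨rfl, rfl⟩ <;> omega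
  have he : G.excess X k (flipArc D a b) = G.excess X k D := by
    refine excess_eq fun v hv _ => ?_
    have hvx : v ≠ x := by rintro rfl; exact hv hx
    by_cases hvy : v = y
    · subst hvy; rcases hor with ⟨rfl, rfl⟩ | ⟨rfl, rfl⟩ <;> omega
    · rw [h3 v hvx hvy]
  have hcmp := hD.compare hA'
  rw [he, hS.capped_eq, hS.numGood_eq] at hcmp
  have hhigh : (outdeg D y < k ∨ a = y) →
      G.numHigh X k (flipArc D a b) = G.numHigh X k D := by
    intro hlt
    refine hS.numHigh_eq fun v hv => ?_
    have hvx : v ≠ x := by rintro rfl; exact hv.1 hx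
    by_cases hvy : v = y
    · subst hvy; rcases hor with ⟨rfl, rfl⟩ | ⟨rfl, rfl⟩ <;> rcases hlt with hlt | hlt <;>
        first | omega | exact absurd hlt hne
    · rw [h3 v hvx hvy]
  have harcs : (outdeg D x < k ∨ b = x) →
      G.numArcs X k D ≤ G.numArcs X k (flipArc D a b) := by
    intro hlt
    refine hS.numArcs_le (fun v hv hvk => ?_) (fun v hv hvk u hu hvu => ?_)
    · have hvy : v ≠ y := by rintro rfl; exact hyX hv
      by_cases hvx : v = x
      · subst hvx; rcases hor with ⟨rfl, rfl⟩ | ⟨rfl, rfl⟩ <;> rcases hlt with hlt | hlt <;>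
        first | omega | exact absurd hlt hne | exact absurd hlt.symm hne
      · rw [h3 v hvx hvy]; exact hvk
    · refine .inr ⟨hvu, ?_⟩
      rintro ⟨rfl, rfl⟩
      rcases hor with ⟨rfl, rfl⟩ | ⟨rfl, rfl⟩
      · rcases hlt with hlt | hlt
        · omega
        · exact absurd hlt.symm hne
      · exact hyX hv
  -- Below `k`, the reversal turns equal values `d, d` into `d + 1, d - 1` and raises the sum of
  -- squares. At `k` it either lifts `y` to `k + 1`, raising `numHigh`, or creates a new arc counted
  -- by `numArcs`.
  by_cases hlt : outdeg D x < k
  · have hw : ∑ v, G.weight X k D v < ∑ v, G.weight X k (flipArc D a b) v := by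
      refine sum_lt_sum_of_pair hne (fun v hvx hvy => ?_) ?_
      · unfold weight
        rw [h3 v hvx hvy, if_congr hS.normal_iff rfl rfl]
      · have hyw : ∀ {D'}, G.Similar X k D D' → G.weight X k D' y = outdeg D' y ^ 2 := by
          intro D' h
          unfold weight
          rw [if_neg hyX, if_pos (h.normal_iff.2 hy)]
        have hyw' : G.weight X k D y = outdeg D y ^ 2 := by
          unfold weight; rw [if_neg hyX, if_pos hy]
        have hxw : ∀ D', outdeg D' x ≤ k → G.weight X k D' x = outdeg D' x ^ 2 := by
          intro D' h
          unfold weight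
          rw [if_pos hx, min_eq_left h]
        rw [hyw hS, hyw', hxw D hxk, hxw]
        · rcases hor with ⟨rfl, rfl⟩ | ⟨rfl, rfl⟩
          · rw [h2, ← heq, ← h1]; nlinarith
          · rw [h2, heq, ← h1]; nlinarith
        · rcases hor with ⟨rfl, rfl⟩ | ⟨rfl, rfl⟩ <;> omega
    have := hhigh (.inl (by omega))
    have := harcs (.inl hlt)
    omega
  · rcases hor with ⟨rfl, rfl⟩ | ⟨rfl, rfl⟩
    · have : G.numHigh X k D < G.numHigh X k (flipArc D a b) := by
        refine card_lt_card ⟨fun v hv => ?_, fun hs => ?_⟩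
        · simp only [mem_filter, mem_univ, true_and, hS.normal_iff] at hv ⊢
          refine ⟨hv.1, ?_⟩
          rw [h3 v (by rintro rfl; exact hv.1.1 hx) (by rintro rfl; omega)]
          exact hv.2
        · have := @hs b (by simp [hS.normal_iff, hy]; omega)
          simp only [mem_filter, mem_univ, true_and] at this
          omega
      omega
    · have h4 := hhigh (.inr rfl)
      have : G.numArcs X k D < G.numArcs X k (flipArc D a b) := by
        refine card_lt_card ⟨fun p hp => ?_, fun hs => ?_⟩
        · simp only [mem_filter, mem_univ, true_and, hS.normal_iff] at hp ⊢
          refine ⟨⟨hp.1.1, ?_⟩, .inr ⟨hp.2.1, fun h => hyX (h.1 ▸ hp.1.1)⟩, hp.2.2⟩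
          by_cases hpx : p.1 = b
          · rw [hpx]; omega
          · rw [h3 _ hpx (fun h => hyX (h ▸ hp.1.1))]; exact hp.1.2
        · have := @hs (b, a) (by
            simp only [mem_filter, mem_univ, true_and, hS.normal_iff]
            exact ⟨⟨hx, by omega⟩, flipArc_self _ _ _, hy⟩)
          simp only [mem_filter, mem_univ, true_and] at this
          exact hO.asymm _ _ hab this.2.1
      omega

end

end Optimal

/-! ### Walks through slack vertices and the final reversal -/

section Links

open scoped Classical

variable {V : Type*} [Fintype V]

/-- The vertex `w'` follows `w` through the slack vertex `z`. -/
structure Link (G : SimpleGraph V) (X : Set V) (k : ℕ) (D : V → V → Prop) (w z w' : V) :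
    Prop where
  slack : G.Slack X k D z
  arc_in : D w z
  arc_out : D z w'
  notMem : w' ∉ capped X k D

/-- Reverse the path from `w` through `z` to `w'`. -/
def flipPath (D : V → V → Prop) (w z w' : V) : V → V → Prop := flipArc (flipArc D w z) z w'

variable {G : SimpleGraph V} {X : Set V} {k : ℕ} {D D' D₀ : V → V → Prop}
  {a b u v w w' x y z z' : V}

omit [Fintype V] in
theorem flipPath_iff_of_ne (ha : a ≠ z) (hb : b ≠ z) : flipPath D w z w' a b ↔ D a b := by
  unfold flipPath
  rw [flipArc_iff_of_ne (by tauto) (by tauto), flipArc_iff_of_ne (by tauto) (by tauto)]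

omit [Fintype V] in
theorem flipPath_out_iff (hw : b ≠ w) (hw' : b ≠ w') : flipPath D w z w' z b ↔ D z b := by
  unfold flipPath
  rw [flipArc_iff_of_ne (by tauto) (by rintro ⟨rfl, rfl⟩; exact hw' rfl),
    flipArc_iff_of_ne (by rintro ⟨rfl, rfl⟩; exact hw rfl) (by tauto)]

omit [Fintype V] in
theorem flipPath_in_iff (hw : a ≠ w) (hw' : a ≠ w') : flipPath D w z w' a z ↔ D a z := by
  unfold flipPath
  rw [flipArc_iff_of_ne (by rintro ⟨rfl, rfl⟩; exact hw' rfl) (by tauto),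
    flipArc_iff_of_ne (by tauto) (by rintro ⟨rfl, rfl⟩; exact hw rfl)]

section

variable (hX : ∀ u v, G.Adj u v → (u ∈ X ↔ v ∉ X)) (hD : G.Optimal X k D)
  (h₀ : G.Orients D₀) (hk : ∀ v, outdeg D₀ v ≤ k)

include hX hD h₀ hk

omit h₀ hk in
/-- Reversing a link at a vertex of outdegree `k + 1` shows that the other end has outdegree `k`,
and leads to another optimal orientation. -/
theorem Optimal.flipPath (hx : w ∈ X) (hw : outdeg D w = k + 1) (hl : G.Link X k D w z w') :
    outdeg D w' = k ∧ outdeg (flipPath D w z w') w' = k + 1 ∧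
    (∀ v, v ≠ w → v ≠ w' → outdeg (flipPath D w z w') v = outdeg D v) ∧
    G.Similar X k D (flipPath D w z w') ∧ G.Optimal X k (flipPath D w z w') := by
  have hA := hD.admissible
  have hO := hA.orients
  have hzX : z ∉ X := hl.slack.1.1
  have hw'X : w' ∈ X := by have := hX _ _ (hO.adj hl.arc_out); tauto
  have hne : w ≠ w' := by rintro rfl; exact hO.asymm _ _ hl.arc_in hl.arc_out
  have hwz := hO.ne hl.arc_in
  have hzw' := hO.ne hl.arc_out
  have hO1 := hO.flipArc hl.arc_in
  have harc : SimpleGraph.flipArc D w z z w' := by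
    rw [flipArc_iff_of_ne (by tauto) (by tauto)]; exact hl.arc_out
  have h1 := hO.outdeg_flipArc_tail hl.arc_in
  have h2 := hO.outdeg_flipArc_head hl.arc_in
  have h3 := hO1.outdeg_flipArc_tail harc
  have h4 := hO1.outdeg_flipArc_head harc
  rw [outdeg_flipArc_of_ne (a := w) hne.symm hzw'.symm] at h4
  have h5 : outdeg (SimpleGraph.flipPath D w z w') w + 1 = outdeg D w := by
    unfold SimpleGraph.flipPath
    rw [outdeg_flipArc_of_ne (a := z) hwz hne]; exact h1
  have h6 : outdeg (SimpleGraph.flipPath D w z w') w' = outdeg D w' + 1 := h4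
  have h7 : ∀ v, v ≠ w → v ≠ w' → outdeg (SimpleGraph.flipPath D w z w') v = outdeg D v := by
    intro v hv hv'
    unfold SimpleGraph.flipPath
    by_cases hvz : v = z
    · subst hvz; omega
    · rw [outdeg_flipArc_of_ne (a := z) hvz hv', outdeg_flipArc_of_ne (a := w) hv hvz]
  have h8 : outdeg D w' ≤ k := by
    have := hA.le_mem w' hw'X
    have : outdeg D w' ≠ k + 2 := fun h => hl.notMem (mem_capped.2 ⟨hw'X, h⟩)
    have : outdeg D w' ≠ k + 1 := fun h =>
      hD.not_arc_to_mem hX hw'X h (.inl hl.slack.1) hl.arc_out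
    omega
  have hO' : G.Orients (SimpleGraph.flipPath D w z w') := hO1.flipArc harc
  have hwC : w ∉ capped X k D := fun h => by have := (mem_capped.1 h).2; omega
  have hindeg : ∀ y, outdeg (SimpleGraph.flipPath D w z w') y = outdeg D y →
      indeg (SimpleGraph.flipPath D w z w') y = indeg D y := by
    intro y hy
    have := hO'.outdeg_add_indeg y
    have := hO.outdeg_add_indeg y
    omega
  have hXne : ∀ y, y ∉ X → outdeg (SimpleGraph.flipPath D w z w') y = outdeg D y :=
    fun y hy => h7 y (by rintro rfl; exact hy hx) (by rintro rfl; exact hy hw'X)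
  have hS : G.Similar X k D (SimpleGraph.flipPath D w z w') := by
    refine ⟨?_, fun v hv u => ?_, fun y hy => hindeg y (hXne y hy.1.1)⟩
    · ext v
      rw [mem_capped, mem_capped]
      refine and_congr_right fun hv => ?_
      by_cases hvw : v = w
      · subst hvw; omega
      by_cases hvw' : v = w'
      · subst hvw'; omega
      rw [h7 v hvw hvw']
    · have hvz : v ≠ z := by rintro rfl; exact hzX (mem_capped.1 hv).1
      have hvw : v ≠ w := by rintro rfl; exact hwC hv
      have hvw' : v ≠ w' := by rintro rfl; exact hl.notMem hv
      by_cases huz : u = z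
      · subst huz; exact flipPath_in_iff hvw hvw'
      · exact flipPath_iff_of_ne hvz huz
  have hA' : G.Admissible X k (SimpleGraph.flipPath D w z w') := by
    refine ⟨hO', fun v hv => ?_, fun v hv => ?_⟩
    · by_cases hvw : v = w
      · subst hvw; omega
      by_cases hvw' : v = w'
      · subst hvw'; omega
      rw [h7 v hvw hvw']; exact hA.le_mem v hv
    · rw [hXne v hv]; exact hA.le_notMem v hv
  have he : G.excess X k (SimpleGraph.flipPath D w z w') = G.excess X k D :=
    excess_eq fun y hy _ => by rw [hXne y hy]
  have hhigh : G.numHigh X k (SimpleGraph.flipPath D w z w') = G.numHigh X k D :=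
    hS.numHigh_eq fun y hy => by rw [hXne y hy.1]
  have hnz : ∀ y, G.Normal X k D y → y ≠ z := by rintro y hy rfl; exact hy.2 hl.slack
  have harcs : G.numArcs X k D ≤ G.numArcs X k (SimpleGraph.flipPath D w z w') := by
    refine hS.numArcs_le (fun v hv hvk => ?_) (fun v hv _ y hy hvy => ?_)
    · by_cases hvw : v = w
      · subst hvw; omega
      by_cases hvw' : v = w'
      · subst hvw'; omega
      rwa [h7 v hvw hvw']
    · exact (flipPath_iff_of_ne (by rintro rfl; exact hzX hv) (hnz y hy)).2 hvy
  have hweight : ∀ v, v ≠ w' →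
      G.weight X k (SimpleGraph.flipPath D w z w') v = G.weight X k D v := by
    intro v hv'
    unfold weight
    by_cases hvw : v = w
    · subst hvw
      rw [if_pos hx, if_pos hx, min_eq_right (by omega), min_eq_right (by omega)]
    · rw [h7 v hvw hv', if_congr hS.normal_iff rfl rfl]
  have hww' : ∀ D', G.weight X k D' w' = min (outdeg D' w') k ^ 2 := by
    intro D'; unfold weight; rw [if_pos hw'X]
  have hcmp := hD.compare hA'
  rw [he, hS.capped_eq, hS.numGood_eq, hhigh] at hcmp
  -- On `X` the weights are truncated at `k`: the fall of `w` from `k + 1` to `k` goes unseen, while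
  -- a `w'` below `k` would gain.
  have h9 : outdeg D w' = k := by
    by_contra hne
    have : ∑ v, G.weight X k D v < ∑ v, G.weight X k (SimpleGraph.flipPath D w z w') v := by
      refine sum_lt_sum (fun v _ => ?_) ⟨w', mem_univ _, ?_⟩
      · by_cases hv : v = w'
        · subst hv
          rw [hww', hww', h6]
          gcongr
          omega
        · rw [hweight v hv]
      · rw [hww', hww', h6, min_eq_left h8, min_eq_left (by omega)]
        gcongr
        omega
    omega
  refine ⟨h9, by omega, h7, hS, hD.of_eq hA' ?_⟩
  have hnum : G.numArcs X k (SimpleGraph.flipPath D w z w') = G.numArcs X k D := by omega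
  have hsum : ∑ v, G.weight X k (SimpleGraph.flipPath D w z w') v = ∑ v, G.weight X k D v := by
    refine sum_congr rfl fun v _ => ?_
    by_cases hv : v = w'
    · subst hv
      rw [hww', hww', min_eq_right (by omega), min_eq_right (by omega)]
    · exact hweight v hv
  unfold potential
  rw [he, hS.capped_eq, hS.numGood_eq, hhigh, hnum, hsum]

omit h₀ hk in
theorem Optimal.ne_of_link (hx : u ∈ X) (hu : outdeg D u = k + 1) (hz : G.IsTight X k z)
    (h : D z w) : w ≠ u := by
  rintro rfl; exact hD.not_arc_to_mem hX hx hu (.inl hz) h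

theorem Optimal.eq_of_arc_in (hz : G.Slack X k D z) (hu : D u z) (hv : D v z) : u = v :=
  eq_of_indeg_eq_one (hz.loose_and_indeg (hD.good hX h₀ hk hz.1)).2 hu hv

end

/-- The ends of walks of links that start at a vertex of outdegree `k + 1`. -/
theorem walk_end (hX : ∀ u v, G.Adj u v → (u ∈ X ↔ v ∉ X)) (h₀ : G.Orients D₀)
    (hk : ∀ v, outdeg D₀ v ≤ k) (n : ℕ) : ∀ (D : V → V → Prop) (w z : ℕ → V), G.Optimal X k D →
    w 0 ∈ X → outdeg D (w 0) = k + 1 → (∀ i < n, G.Link X k D (w i) (z i) (w (i + 1))) →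
    (∀ z', G.IsTight X k z' → D z' (w n) → ∃ i, n = i + 1 ∧ z' = z i) ∧
    (∀ y, G.Normal X k D y → G.Adj y (w n) → outdeg D y ≠ k + 1) ∧
    (∀ z' w', G.Link X k D (w n) z' w' → outdeg D w' = k) := by
  induction n with
  | zero =>
    intro D w z hD hw0 hw hstep
    refine ⟨fun z' hz' hz'w => absurd hz'w (hD.not_arc_to_mem hX hw0 hw (.inl hz')),
      fun y hy hadj hyk => ?_, fun z' w' hl => (hD.flipPath hX hw0 hw hl).1⟩
    exact hy.2 (hD.of_outdeg_eq hX h₀ hk hw0 hadj.symm (by omega)).2.2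
  | succ n ih =>
    intro D w z hD hw0 hw hstep
    have hl0 := hstep 0 (by omega)
    -- After reversing the first link, the remaining walk starts at `w 1`, which now has outdegree
    -- `k + 1`, in an optimal orientation.
    obtain ⟨h1, h2, h3, hS, hD1⟩ := hD.flipPath hX hw0 hw hl0
    have hO := hD.admissible.orients
    have hw1 : w 1 ∈ X := by
      have := hX _ _ (hO.adj hl0.arc_out); have := hl0.slack.1.1; simp only [zero_add] at *; tauto
    simp only [zero_add] at *
    set D1 := flipPath D (w 0) (z 0) (w 1) with hD1def
    have hXz : ∀ {u z'}, u ∈ X → G.IsTight X k z' → u ≠ z' := by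
      rintro u z' hu hz' rfl; exact hz'.1 hu
    have hwX : ∀ i, i ≤ n + 1 → w i ∈ X := by
      intro i hi
      rcases i with _ | i
      · exact hw0
      · have h := hstep i (by omega)
        have := hX _ _ (hO.adj h.arc_out); have := h.slack.1.1; tauto
    have hwne : ∀ i, i ≤ n → w (i + 1) ≠ w 0 := by
      intro i hi
      have h := hstep i (by omega)
      exact hD.ne_of_link hX hw0 hw h.slack.1 h.arc_out
    -- A slack vertex has a single in-neighbour, so later links avoid `z 0` and survive the
    -- reversal.
    have hin : ∀ i, i ≤ n → ∀ z', D (w (i + 1)) z' → z' ≠ z 0 := by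
      rintro i hi z' hz' rfl
      exact hwne i hi (hD.eq_of_arc_in hX h₀ hk hl0.slack hz' hl0.arc_in)
    have hlink : ∀ i, i ≤ n → ∀ z' w', G.Link X k D (w (i + 1)) z' w' →
        G.Link X k D1 (w (i + 1)) z' w' := by
      intro i hi z' w' h
      have hz' := hin i hi z' h.arc_in
      have hw' : w' ∈ X := by
        have := hX _ _ (hO.adj h.arc_out); have := h.slack.1.1; tauto
      exact ⟨hS.slack_iff.2 h.slack,
        (flipPath_iff_of_ne (hXz (hwX _ (by omega)) hl0.slack.1) hz').2 h.arc_in,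
        (flipPath_iff_of_ne hz' (hXz hw' hl0.slack.1)).2 h.arc_out,
        by rw [hS.capped_eq]; exact h.notMem⟩
    obtain ⟨ha, hb, hc⟩ := ih D1 (fun i => w (i + 1)) (fun i => z (i + 1)) hD1 hw1 h2
      (fun i hi => hlink i (by omega) _ _ (hstep (i + 1) (by omega)))
    have hwn0 := hXz (hwX (n + 1) le_rfl) hl0.slack.1
    refine ⟨fun z' hz' hz'w => ?_, fun y hy hadj => ?_, fun z' w' hl => ?_⟩
    · refine ⟨n, rfl, ?_⟩
      -- On a longer walk, an arc from `z 0` to the end survives the reversal and contradicts the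
      -- induction hypothesis, unless the end is `w 1`; but then the last link would enter a vertex
      -- of outdegree `k + 1` from a tight one.
      by_cases hz0 : z' = z 0
      · rcases n with _ | n
        · exact hz0
        exfalso
        have hzn := hin n (by omega) _ (hstep (n + 1) (by omega)).arc_in
        by_cases hwn1 : w (n + 1 + 1) = w 1
        · have harc : D1 (z (n + 1)) (w (n + 1 + 1)) :=
            (flipPath_iff_of_ne hzn hwn0).2 (hstep (n + 1) (by omega)).arc_out
          exact hD1.ne_of_link hX hw1 h2 (hstep (n + 1) (by omega)).slack.1 harc hwn1
        · have harc : D1 z' (w (n + 1 + 1)) := by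
            subst hz0
            exact (flipPath_out_iff (hwne (n + 1) le_rfl) hwn1).2 hz'w
          obtain ⟨i, hi, hzi⟩ := ha z' hz' harc
          obtain rfl : i = n := by omega
          exact hzn (hzi ▸ hz0)
      · obtain ⟨i, rfl, hi⟩ := ha z' hz' ((flipPath_iff_of_ne hz0 hwn0).2 hz'w)
        exact hi
    · have h4 := hb y (hS.normal_iff.2 hy) hadj
      rwa [h3 y (by rintro rfl; exact hy.1 hw0) (by rintro rfl; exact hy.1 hw1)] at h4
    · have hl1 := hlink n le_rfl z' w' hl
      have h4 := hc z' w' hl1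
      rwa [h3 w' (hD.ne_of_link hX hw0 hw hl.slack.1 hl.arc_out)
        (hD1.ne_of_link hX hw1 h2 hl.slack.1 hl1.arc_out)] at h4

/-- A walk of `n` links from a vertex of outdegree `k + 1` ends at `v`, and its last link, if any,
goes through `z'`. -/
def LinkReach (G : SimpleGraph V) (X : Set V) (k : ℕ) (D : V → V → Prop) (n : ℕ) (v z' : V) :
    Prop :=
  ∃ w z : ℕ → V, w 0 ∈ X ∧ outdeg D (w 0) = k + 1 ∧
    (∀ i < n, G.Link X k D (w i) (z i) (w (i + 1))) ∧ w n = v ∧ z (n - 1) = z'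

/-- A bipartite graph with an orientation of outdegrees at most `k` has a proper orientation of
outdegrees at most `k + 3`. -/
theorem exists_proper_of_orients (hX : ∀ u v, G.Adj u v → (u ∈ X ↔ v ∉ X)) (h₀ : G.Orients D₀)
    (hk : ∀ v, outdeg D₀ v ≤ k) :
    ∃ D, G.Orients D ∧ (∀ u v, G.Adj u v → outdeg D u ≠ outdeg D v) ∧
      ∀ v, outdeg D v ≤ k + 3 := by
  obtain ⟨D, hD⟩ := exists_optimal (X := X) (k := k) (D := D₀)
    ⟨h₀, fun v _ => (hk v).trans (by omega), fun v _ => (hk v).trans (by omega)⟩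
  have hA := hD.admissible
  have hO := hA.orients
  have hr0 : ∀ v ∈ X, outdeg D v = k + 1 → G.LinkReach X k D 0 v v :=
    fun v hv h => ⟨fun _ => v, fun _ => v, hv, h, by simp, rfl, rfl⟩
  have hr1 : ∀ n v z₀ z w, G.LinkReach X k D n v z₀ → G.Link X k D v z w →
      G.LinkReach X k D (n + 1) w z := by
    rintro n v z₀ z w ⟨p, q, h1, h2, h3, rfl, -⟩ hl
    refine ⟨fun i => if i ≤ n then p i else w, fun i => if i < n then q i else z, by simpa,
      by simpa, fun i hi => ?_, by simp, by simp⟩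
    by_cases hin : i = n
    · subst hin; simpa using hl
    · simpa [show i < n by omega, show i ≤ n by omega, show i + 1 ≤ n by omega]
        using h3 i (by omega)
  have hmem : ∀ n v z₀, G.LinkReach X k D n v z₀ → v ∈ X := by
    rintro n v z₀ ⟨p, q, h1, h2, h3, rfl, -⟩
    rcases n with _ | n
    · exact h1
    · have h := h3 n (by omega)
      have := hX _ _ (hO.adj h.arc_out); have := h.slack.1.1; tauto
  have hend : ∀ n v z₀, G.LinkReach X k D n v z₀ →
      (∀ z', G.IsTight X k z' → D z' v → n ≠ 0 ∧ z' = z₀) ∧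
      (∀ y, G.Normal X k D y → G.Adj y v → outdeg D y ≠ k + 1) ∧
      (∀ z' w', G.Link X k D v z' w' → outdeg D w' = k) := by
    rintro n v z₀ ⟨p, q, h1, h2, h3, rfl, rfl⟩
    obtain ⟨ha, hb, hc⟩ := walk_end hX h₀ hk n D p q hD h1 h2 h3
    refine ⟨fun z' hz' h => ?_, hb, hc⟩
    obtain ⟨i, rfl, rfl⟩ := ha z' hz' h
    simp
  set A : Set V := {z | G.Slack X k D z ∧ ∃ n w z₀, G.LinkReach X k D n w z₀ ∧ D w z} with hAdef
  set C := capped X k D with hC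
  have hCX : ∀ {x}, x ∈ C → x ∈ X := fun hx => (mem_capped.1 hx).1
  have hAX : ∀ {z}, z ∈ A → z ∉ X := fun hz => hz.1.1.1
  -- the vertices reached from members of `A`
  have hchange : ∀ z ∈ A, ∀ x, D z x → x ∉ C → outdeg D x = k ∧
      ∃ n, G.LinkReach X k D (n + 1) x z := by
    rintro z ⟨hz, n, w, z₀, hr, hwz⟩ x hzx hxC
    have hl : G.Link X k D w z x := ⟨hz, hwz, hzx, hxC⟩
    exact ⟨(hend n w z₀ hr).2.2 z x hl, n, hr1 n w z₀ z x hr hl⟩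
  set D' : V → V → Prop :=
    fun a b => (D a b ∧ ¬ (a ∈ A ∧ b ∉ C)) ∨ (D b a ∧ b ∈ A ∧ a ∉ C) with hD'
  have hO' : G.Orients D' := by
    constructor
    · intro u v; have := hO.adj_iff u v; simp only [hD']; tauto
    · intro u v
      have := hO.asymm u v
      simp only [hD']
      tauto
  have hout1 : ∀ y, y ∉ X → y ∉ A → outdeg D' y = outdeg D y := by
    intro y hy hyA
    refine outdeg_congr fun x => ?_
    constructor
    · rintro (h | h)
      · exact h.1
      · have := hX _ _ (hO.adj h.1); have := hAX h.2.1; tauto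
    · intro h; exact .inl ⟨h, fun h' => hyA h'.1⟩
  -- Only arcs to capped vertices still leave `z`, and by looseness at least two of its `k + 2`
  -- neighbours are not capped.
  have hout2 : ∀ z ∈ A, outdeg D' z ≤ k := by
    intro z hz
    have h1 := (hz.1.loose_and_indeg (hD.good hX h₀ hk hz.1.1)).1
    change 2 ≤ #{x | G.Adj z x ∧ x ∉ C} at h1
    have h2 : outdeg D' z + #{x | G.Adj z x ∧ x ∉ C} ≤ G.deg z := by
      unfold outdeg deg
      rw [← card_union_of_disjoint]
      · refine card_le_card fun x hx => ?_
        simp only [mem_union, mem_filter, mem_univ, true_and] at hx ⊢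
        rcases hx with hx | hx
        · exact hO'.adj hx
        · exact hx.1
      · rw [Finset.disjoint_left]
        intro x hx hx'
        simp only [mem_filter, mem_univ, true_and] at hx hx'
        rcases hx with hx | hx
        · exact hx.2 ⟨hz, hx'.2⟩
        · have := hX _ _ (hO.adj hx.1); have := hAX hx.2.1; have := hAX hz; tauto
    have h3 := hz.1.1.2
    omega
  have hout3 : ∀ x ∈ X, (x ∈ C ∨ ∀ z ∈ A, ¬ D z x) → outdeg D' x = outdeg D x := by
    intro x hx h
    refine outdeg_congr fun y => ?_
    constructor
    · rintro (h' | h')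
      · exact h'.1
      · rcases h with h | h
        · exact absurd h h'.2.2
        · exact absurd h'.1 (h y h'.2.1)
    · intro h'; exact .inl ⟨h', fun h'' => hAX h''.1 hx⟩
  -- Exactly one member of `A` points to `x`, namely the one on the last link, so `x` gains exactly
  -- one arc.
  have hout4 : ∀ x, x ∉ C → ∀ z ∈ A, D z x → outdeg D' x = k + 1 := by
    intro x hxC z hz hzx
    obtain ⟨h1, n, hr⟩ := hchange z hz x hzx hxC
    have h2 : outdeg D' x = #(insert z ({y | D x y} : Finset V)) := by
      unfold outdeg
      congr 1
      ext y
      simp only [mem_filter, mem_univ, true_and, mem_insert]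
      constructor
      · rintro (h | h)
        · exact .inr h.1
        · exact .inl ((hend _ _ _ hr).1 y h.2.1.1.1 h.1).2
      · rintro (rfl | h)
        · exact .inr ⟨hzx, hz, hxC⟩
        · exact .inl ⟨h, fun h' => hAX h'.1 (hmem _ _ _ hr)⟩
    have h3 : z ∉ ({y | D x y} : Finset V) := by simpa using hO.asymm _ _ hzx
    rw [h2, card_insert_of_notMem h3]
    exact congrArg (· + 1) h1
  have hkey : ∀ x y, x ∈ X → G.Adj x y → outdeg D' x ≠ outdeg D' y := by
    intro x y hx hxy heq
    have hyX : y ∉ X := (hX _ _ hxy).1 hx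
    by_cases hch : x ∉ C ∧ ∃ z ∈ A, D z x
    · obtain ⟨hxC, z, hz, hzx⟩ := hch
      have hx1 := hout4 x hxC z hz hzx
      by_cases hyA : y ∈ A
      · have := hout2 y hyA; omega
      rw [hx1, hout1 y hyX hyA] at heq
      obtain ⟨-, n, hr⟩ := hchange z hz x hzx hxC
      obtain ⟨ha, hb, -⟩ := hend _ _ _ hr
      have hys : G.Slack X k D y := by
        by_contra hys
        exact hb y ⟨hyX, hys⟩ hxy.symm heq.symm
      rcases (hO.adj_iff x y).1 hxy with h | h
      · exact hyA ⟨hys, _, _, _, hr, h⟩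
      · rw [(ha y hys.1 h).2] at hyA; exact hyA hz
    · have hch' : x ∈ C ∨ ∀ z ∈ A, ¬ D z x := by
        by_cases hxC : x ∈ C
        · exact .inl hxC
        · exact .inr fun z hz hzx => hch ⟨hxC, z, hz, hzx⟩
      rw [hout3 x hx hch'] at heq
      by_cases hyA : y ∈ A
      · have h1 := hout2 y hyA
        by_cases hxC : x ∈ C
        · have := (mem_capped.1 hxC).2; omega
        have hnot := hch'.resolve_left hxC y hyA
        have hxy' := ((hO.adj_iff x y).1 hxy).resolve_right hnot
        obtain ⟨hys, n, w, z₀, hr, hwy⟩ := id hyA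
        obtain rfl := hD.eq_of_arc_in hX h₀ hk hys hxy' hwy
        -- `x` ends the walk that put `y` into `A`. Either it is the start, of outdegree `k + 1`, or
        -- the last link points to it and its outdegree was changed after all.
        obtain ⟨p, q, h2, h3, h4, h5, -⟩ := hr
        rcases n with _ | n
        · subst h5; omega
        · have hl := h4 n (by omega)
          refine hch ⟨hxC, q n, ⟨hl.slack, n, p n, q (n - 1), ?_, hl.arc_in⟩, h5 ▸ hl.arc_out⟩
          exact ⟨p, q, h2, h3, fun i hi => h4 i (by omega), rfl, rfl⟩
      · rw [hout1 y hyX hyA] at heq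
        obtain ⟨h1, h2, h3⟩ := hD.of_outdeg_eq hX h₀ hk hx hxy heq
        exact hyA ⟨h3, 0, x, x, hr0 x hx h1, h2⟩
  refine ⟨D', hO', fun u v huv => ?_, fun v => ?_⟩
  · by_cases hu : u ∈ X
    · exact hkey u v hu huv
    · have := hX _ _ huv
      exact (hkey v u (by tauto) huv.symm).symm
  · by_cases hv : v ∈ X
    · by_cases hch : v ∉ C ∧ ∃ z ∈ A, D z v
      · obtain ⟨h1, z, hz, hzv⟩ := hch
        have := hout4 v h1 z hz hzv; omega
      · rw [hout3 v hv]
        · exact (hA.le_mem v hv).trans (by omega)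
        · by_cases hvC : v ∈ C
          · exact .inl hvC
          · exact .inr fun z hz hzx => hch ⟨hvC, z, hz, hzx⟩
    · by_cases hvA : v ∈ A
      · exact (hout2 v hvA).trans (by omega)
      · rw [hout1 v hv hvA]; exact hA.le_notMem v hv

end Links

/-! ### Maximum average degree and bounded orientations -/

section Density

open scoped Classical

variable {V : Type*} [Fintype V] {G : SimpleGraph V} {D : V → V → Prop} {k m : ℕ}

omit [Fintype V] in
theorem two_mul_ncard_div_le_maxAvgDegree [Finite V] (H : G.Subgraph) (h : H.verts.Nonempty) :
    2 * (H.edgeSet.ncard : ℝ) / (H.verts.ncard : ℝ) ≤ G.maxAvgDegree := by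
  refine le_csSup ?_ ⟨H, h, rfl⟩
  refine ((Set.finite_range fun H : G.Subgraph =>
    2 * (H.edgeSet.ncard : ℝ) / (H.verts.ncard : ℝ)).subset ?_).bddAbove
  rintro _ ⟨H, -, rfl⟩
  exact ⟨H, rfl⟩

/-- Charge each edge of a subgraph to the tail of its arc. -/
theorem Orients.ceil_maxAvgDegree_le (h : G.Orients D) (hm : ∀ v, outdeg D v ≤ m) :
    ⌈(1 / 2 : ℝ) * G.maxAvgDegree⌉₊ ≤ m := by
  rw [Nat.ceil_le]
  suffices G.maxAvgDegree ≤ 2 * m by linarith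
  refine Real.sSup_le ?_ (by positivity)
  rintro _ ⟨H, hne, rfl⟩
  have hpos : 0 < H.verts.ncard := (Set.ncard_pos (Set.toFinite _)).2 hne
  rw [div_le_iff₀ (by exact_mod_cast hpos)]
  have key : H.edgeSet.ncard ≤ m * H.verts.ncard := by
    have hsub : H.edgeSet ⊆ ((H.verts.toFinset.sigma fun u => ({w | D u w} : Finset V)).image
        fun p => s(p.1, p.2) : Finset (Sym2 V)) := by
      intro e he
      induction e using Sym2.ind with
      | _ u v =>
        have huv : H.Adj u v := he
        rw [coe_image]
        rcases (h.adj_iff u v).1 huv.adj_sub with h1 | h1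
        · exact ⟨⟨u, v⟩, by simpa using ⟨huv.fst_mem, h1⟩, rfl⟩
        · exact ⟨⟨v, u⟩, by simpa using ⟨huv.snd_mem, h1⟩, Sym2.eq_swap⟩
    refine (Set.ncard_le_ncard hsub (Set.toFinite _)).trans ?_
    rw [Set.ncard_coe_finset]
    refine card_image_le.trans ?_
    rw [card_sigma, mul_comm, Set.ncard_eq_toFinset_card', ← smul_eq_mul]
    exact sum_le_card_nsmul _ _ _ fun u _ => hm u
  have : (H.edgeSet.ncard : ℝ) ≤ m * H.verts.ncard := by exact_mod_cast key
  linarith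

/-- A graph has an orientation whose outdegrees are at most half its maximum average degree,
rounded up. -/
theorem exists_orients_of_maxAvgDegree_le (h : (1 / 2 : ℝ) * G.maxAvgDegree ≤ k) :
    ∃ D, G.Orients D ∧ ∀ v, outdeg D v ≤ k := by
  -- Every vertex offers `k` slots and every edge must choose a slot at one of its ends, which
  -- becomes its tail.
  obtain ⟨f, hf, hfe⟩ := (all_card_le_biUnion_card_iff_exists_injective
    (fun e : G.edgeSet => ({p | p.1 ∈ e.1} : Finset (V × Fin k)))).1 (by
      intro S
      rcases S.eq_empty_or_nonempty with rfl | hS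
      · simp
      let W : Finset V := {v | ∃ e ∈ S, v ∈ e.1}
      have hW : S.biUnion (fun e : G.edgeSet => ({p | p.1 ∈ e.1} : Finset (V × Fin k))) =
          W ×ˢ univ := by
        ext p; simp [W]
      rw [hW, card_product, card_univ, Fintype.card_fin]
      -- Hall's condition for `S` is the density bound for the subgraph formed by the edges in `S`.
      let H : G.Subgraph :=
        { verts := W
          Adj := fun u v => ∃ e ∈ S, e.1 = s(u, v)
          adj_sub := by
            rintro u v ⟨e, -, he⟩
            have := e.2
            rwa [he] at this
          edge_vert := by
            rintro u v ⟨e, heS, he⟩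
            simp only [W, coe_filter, mem_univ, true_and, Set.mem_ofPred_eq]
            exact ⟨e, heS, by simp [he]⟩
          symm := by
            constructor
            rintro u v ⟨e, heS, he⟩
            exact ⟨e, heS, by rw [he, Sym2.eq_swap]⟩ }
      have hE : H.edgeSet = ((S.image Subtype.val : Finset (Sym2 V)) : Set (Sym2 V)) := by
        ext e
        induction e using Sym2.ind with
        | _ u v =>
          rw [Subgraph.mem_edgeSet, mem_coe, mem_image]
      have hWne : W.Nonempty := by
        obtain ⟨e, he⟩ := hS
        obtain ⟨e, he'⟩ := e
        induction e using Sym2.ind with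
        | _ u v => exact ⟨u, by simpa [W] using ⟨_, ⟨he', he⟩, Sym2.mem_mk_left u v⟩⟩
      have h1 := two_mul_ncard_div_le_maxAvgDegree H (by simpa [H] using hWne)
      have h2 : H.verts.ncard = #W := Set.ncard_coe_finset W
      rw [hE, Set.ncard_coe_finset, card_image_of_injective _ Subtype.val_injective, h2,
        div_le_iff₀ (by exact_mod_cast hWne.card_pos)] at h1
      have h3 : (0 : ℝ) ≤ #W := by positivity
      have h4 : (#S : ℝ) ≤ #W * k := by nlinarith
      exact_mod_cast h4)
  refine ⟨fun u v => ∃ e : G.edgeSet, e.1 = s(u, v) ∧ (f e).1 = u, ⟨fun u v => ?_, ?_⟩,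
    fun v => ?_⟩
  · constructor
    · intro huv
      have := hfe ⟨s(u, v), huv⟩
      simp only [mem_filter, mem_univ, true_and, Sym2.mem_iff] at this
      exact this.imp (fun h => ⟨_, rfl, h⟩) (fun h => ⟨_, Sym2.eq_swap, h⟩)
    · rintro (⟨e, h, -⟩ | ⟨e, h, -⟩) <;> have := e.2 <;> rw [h] at this
      · exact this
      · exact (G.mem_edgeSet.1 this).symm
  · rintro u v ⟨e, h1, h2⟩ ⟨e', h3, h4⟩
    obtain rfl : e = e' := Subtype.ext (by rw [h1, h3, Sym2.eq_swap])
    have := e.2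
    rw [h1] at this
    exact G.ne_of_adj this (h2.symm.trans h4)
  · unfold outdeg
    rw [← Fintype.card_subtype]
    conv_rhs => rw [← Fintype.card_fin k]
    choose e he using fun w : {w // ∃ e : G.edgeSet, e.1 = s(v, w) ∧ (f e).1 = v} => w.2
    refine Fintype.card_le_of_injective (fun w => (f (e w)).2) fun w w' h => ?_
    have h1 := hf (Prod.ext ((he w).2.trans (he w').2.symm) h)
    have h2 := (he w).1
    rw [h1, (he w').1] at h2
    exact Subtype.ext (Sym2.congr_right.1 h2.symm)

theorem encard_eq_outdeg (D : Digraph V) (v : V) :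
    {w | D.Adj v w}.encard = (outdeg D.Adj v : ℕ∞) := by
  unfold outdeg
  rw [← Set.encard_coe_eq_coe_finsetCard]
  simp

omit [Fintype V] in
theorem IsOrientation.orients {D : Digraph V} (h : G.IsOrientation D) : G.Orients D.Adj :=
  ⟨h.adj_iff, h.asymm⟩

theorem IsProperOrientation.outdeg_ne {D : Digraph V} (h : G.IsProperOrientation D) {u v : V}
    (huv : G.Adj u v) : outdeg D.Adj u ≠ outdeg D.Adj v := by
  have := h.outdegree_ne u v huv
  rw [encard_eq_outdeg, encard_eq_outdeg] at this
  exact_mod_cast this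

theorem le_properChromaticNumber
    (h : ∀ D : Digraph V, G.IsProperOrientation D → (∀ v, outdeg D.Adj v < m) → False) :
    (m : ℕ∞) ≤ G.properChromaticNumber := by
  refine le_iInf₂ fun D hD => ?_
  by_contra! hlt
  refine h D hD fun v => ?_
  have := (le_iSup (fun v => {w | D.Adj v w}.encard) v).trans_lt hlt
  rw [encard_eq_outdeg] at this
  exact_mod_cast this

omit [Fintype V] in
theorem ceil_maxAvgDegree_le_properChromaticNumber [Finite V] :
    ((⌈(1 / 2 : ℝ) * G.maxAvgDegree⌉₊ : ℕ) : ℕ∞) ≤ G.properChromaticNumber := by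
  have := Fintype.ofFinite V
  rcases Nat.eq_zero_or_pos ⌈(1 / 2 : ℝ) * G.maxAvgDegree⌉₊ with h0 | h0
  · rw [h0]; simp
  refine le_properChromaticNumber fun D hD hlt => ?_
  have := hD.toIsOrientation.orients.ceil_maxAvgDegree_le (fun v => Nat.le_sub_one_of_lt (hlt v))
  omega

omit [Fintype V] in
theorem IsBipartite.properChromaticNumber_le [Finite V] (h : G.IsBipartite) :
    G.properChromaticNumber ≤ ((⌈(1 / 2 : ℝ) * G.maxAvgDegree⌉₊ + 3 : ℕ) : ℕ∞) := by
  have := Fintype.ofFinite V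
  obtain ⟨c⟩ := h
  obtain ⟨D₀, h₀, hk⟩ := exists_orients_of_maxAvgDegree_le (G := G) (Nat.le_ceil _)
  obtain ⟨D, hD, hne, hle⟩ := exists_proper_of_orients (X := {v | c v = 0}) (fun u v huv => by
    have := c.valid huv
    simp only [Set.mem_ofPred_eq]
    omega) h₀ hk
  have hP : G.IsProperOrientation (Digraph.mk D) := by
    refine ⟨⟨hD.adj_iff, hD.asymm⟩, fun u v huv => ?_⟩
    rw [encard_eq_outdeg, encard_eq_outdeg]
    exact_mod_cast hne u v huv
  refine (iInf₂_le _ hP).trans (iSup_le fun v => ?_)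
  rw [encard_eq_outdeg]
  exact_mod_cast hle v

end Density

/-! ### Sharpness: a blown-up tree -/

section TightExample

open scoped Classical

/-- The nodes of a rooted tree. There is a centre for every pair `(j, o)`, a child of the root if
`o = none` and of the centre `(j, none)` otherwise. Every centre has children of two kinds, leaves
`a` and nodes `p` with one child `l`. -/
inductive Node (N : ℕ) : Type
  | root
  | c (x : Fin N × Option (Fin N))
  | a (x : Fin N × Option (Fin N)) (s : Fin N)
  | p (x : Fin N × Option (Fin N)) (s : Fin N)
  | l (x : Fin N × Option (Fin N)) (s : Fin N)

namespace Node

variable {N : ℕ}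

/-- An encoding that shows that there are finitely many nodes. -/
def code : Node N → Option ((Fin N × Option (Fin N)) × Option (Fin N × Fin 3))
  | root => none
  | c x => some (x, none)
  | a x s => some (x, some (s, 0))
  | p x s => some (x, some (s, 1))
  | l x s => some (x, some (s, 2))

instance : Finite (Node N) := Finite.of_injective code (by
  rintro (_ | _ | _ | _ | _) (_ | _ | _ | _ | _) <;> simp +contextual [code])

noncomputable instance : Fintype (Node N) := Fintype.ofFinite _

/-- The parent of a node. -/
def parent : Node N → Option (Node N)
  | root => none
  | c (_, none) => some root
  | c (j, some _) => some (c (j, none))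
  | a x _ => some (c x)
  | p x _ => some (c x)
  | l x s => some (p x s)

/-- The parity of the distance from the root. -/
def parity : Node N → Bool
  | root => false
  | c (_, none) => true
  | c (_, some _) => false
  | a (_, none) _ => false
  | a (_, some _) _ => true
  | p (_, none) _ => false
  | p (_, some _) _ => true
  | l (_, none) _ => true
  | l (_, some _) _ => false

/-- Whether a node is of the kind `l`. -/
def IsSingle : Node N → Prop
  | l _ _ => True
  | _ => False

theorem parity_ne {u v : Node N} (h : u.parent = some v) : u.parity ≠ v.parity := by
  rcases u with _ | ⟨_, _ | _⟩ | ⟨⟨_, _ | _⟩, _⟩ | ⟨⟨_, _ | _⟩, _⟩ | ⟨⟨_, _ | _⟩, _⟩ <;>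
    simp only [parent, Option.some.injEq, reduceCtorEq] at h <;> subst h <;> simp [parity]

theorem not_parent_of_parent {u v : Node N} (h : u.parent = some v) : v.parent ≠ some u := by
  rcases u with _ | ⟨_, _ | _⟩ | ⟨⟨_, _ | _⟩, _⟩ | ⟨⟨_, _ | _⟩, _⟩ | ⟨⟨_, _ | _⟩, _⟩ <;>
    simp only [parent, Option.some.injEq, reduceCtorEq] at h <;> subst h <;> simp [parent]

theorem parent_ne_a (u : Node N) (x : Fin N × Option (Fin N)) (s : Fin N) :
    u.parent ≠ some (a x s) := by
  rcases u with _ | ⟨_, _ | _⟩ | _ | _ | _ <;> simp [parent]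

theorem parent_ne_l (u : Node N) (x : Fin N × Option (Fin N)) (s : Fin N) :
    u.parent ≠ some (l x s) := by
  rcases u with _ | ⟨_, _ | _⟩ | _ | _ | _ <;> simp [parent]

theorem eq_of_parent_eq_p {u : Node N} {x : Fin N × Option (Fin N)} {s : Fin N}
    (h : u.parent = some (p x s)) : u = l x s := by
  rcases u with _ | ⟨_, _ | _⟩ | _ | _ | _ <;> simp_all [parent]

end Node

open Node

variable {k N : ℕ}

/-- Every node is blown up to `k` vertices, of which only one is in use for nodes of the kind `l`;
the vertex `u` lies over a child of the node below `v`. -/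
def ChildOf (u v : Node N × Fin k) : Prop :=
  u.1.parent = some v.1 ∧ (u.1.IsSingle → u.2.val = 0)

/-- The blow-up of the tree. -/
def blowUp (k N : ℕ) : SimpleGraph (Node N × Fin k) where
  Adj u v := ChildOf u v ∨ ChildOf v u
  symm := ⟨fun _ _ h => h.symm⟩
  loopless := ⟨fun _ h => parity_ne (h.elim And.left And.left) rfl⟩

theorem blowUp_isBipartite : (blowUp k N).IsBipartite := by
  refine (Coloring.mk (fun u : Node N × Fin k => u.1.parity) ?_ :
    (blowUp k N).Coloring Bool).colorable
  rintro u v (h | h)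
  · exact parity_ne h.1
  · exact (parity_ne h.1).symm

theorem card_fiber (y : Node N) : #{w : Node N × Fin k | w.1 = y} = k := by
  have : ({w | w.1 = y} : Finset (Node N × Fin k)) = {y} ×ˢ univ := by
    ext ⟨w, i⟩; simp [eq_comm]
  rw [this, card_product]
  simp

/-- Orient every edge towards the parent, over which there are only `k` vertices. -/
theorem ceil_maxAvgDegree_blowUp_le : ⌈(1 / 2 : ℝ) * (blowUp k N).maxAvgDegree⌉₊ ≤ k := by
  refine Orients.ceil_maxAvgDegree_le (D := ChildOf)
    ⟨fun u v => Iff.rfl, fun _ _ h h' => not_parent_of_parent h.1 h'.1⟩ fun u => ?_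
  cases hp : u.1.parent with
  | none =>
    have : outdeg ChildOf u = 0 := by
      unfold outdeg
      rw [card_eq_zero, filter_eq_empty_iff]
      intro w _ h
      rw [h.1] at hp
      simp at hp
    omega
  | some y =>
    refine le_trans (card_le_card fun w hw => ?_) (card_fiber y).le
    simp only [mem_filter, mem_univ, true_and] at hw ⊢
    have := hw.1.symm.trans hp
    simpa using this

variable {D : Node N × Fin k → Node N × Fin k → Prop}

/-- One among many children of a node sends all its arcs to this node. -/
theorem exists_child_all_arcs (hD : (blowUp k N).Orients D) (hle : ∀ v, outdeg D v ≤ k + 2)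
    (hN : k * (k + 2) < N) (y : Node N) (ch : Fin N → Node N) (hinj : Function.Injective ch)
    (hch : ∀ s, (ch s).parent = some y) (hs : ∀ s, ¬ (ch s).IsSingle) :
    ∃ s, ∀ i j, D (ch s, i) (y, j) := by
  -- Otherwise every child receives an arc from over `y`, whereas at most `k * (k + 2)` arcs leave
  -- those `k` vertices.
  by_contra! hcon
  choose i j hij using hcon
  have hback : ∀ s, D (y, j s) (ch s, i s) := fun s =>
    ((hD.adj_iff _ _).1 (.inl ⟨hch s, fun h => absurd h (hs s)⟩)).resolve_left (hij s)
  have h1 : #((univ : Finset (Fin k)).sigma fun j => ({w | D (y, j) w} : Finset (Node N × Fin k)))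
      ≤ k * (k + 2) := by
    rw [card_sigma]
    refine (sum_le_card_nsmul _ _ (k + 2) fun j _ => hle (y, j)).trans ?_
    simp
  have h2 : #(univ : Finset (Fin N)) ≤
      #((univ : Finset (Fin k)).sigma fun j => ({w | D (y, j) w} : Finset (Node N × Fin k))) := by
    refine card_le_card_of_injOn (fun s => ⟨j s, (ch s, i s)⟩) (fun s _ => ?_) ?_
    · simpa using hback s
    · intro s _ s' _ h
      simp only [Sigma.mk.injEq] at h
      obtain ⟨h1, h2⟩ := h
      have := eq_of_heq h2
      simp only [Prod.mk.injEq] at this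
      exact hinj this.1
  simp only [card_univ, Fintype.card_fin] at h2
  omega

theorem outdeg_eq_of_fiber {v : Node N × Fin k} {y : Node N} (h : ∀ j, D v (y, j))
    (h' : ∀ w, D v w → w.1 = y) : outdeg D v = k := by
  refine Eq.trans ?_ (card_fiber (k := k) y)
  unfold outdeg
  congr 1
  ext ⟨w, j⟩
  simp only [mem_filter, mem_univ, true_and]
  constructor
  · exact h' _
  · rintro rfl; exact h j

theorem le_outdeg_of_fiber {v : Node N × Fin k} {y : Node N} (h : ∀ j, D v (y, j)) :
    k ≤ outdeg D v := by
  refine (card_fiber (k := k) y).ge.trans (card_le_card ?_)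
  rintro ⟨w, j⟩ hw
  simp only [mem_filter, mem_univ, true_and] at hw ⊢
  subst hw
  exact h j

section

variable (hD : (blowUp k N).Orients D) (hle : ∀ v, outdeg D v ≤ k + 2)
  (hne : ∀ u v, (blowUp k N).Adj u v → outdeg D u ≠ outdeg D v) (hk : 1 ≤ k)
  (hN : k * (k + 2) < N)

include hD hle hne hk hN

omit hk in
-- A leaf child sending all its arcs up has outdegree `k`.
theorem outdeg_centre_ne (x : Fin N × Option (Fin N)) (j : Fin k) :
    outdeg D (c x, j) ≠ k := by
  obtain ⟨s, hs⟩ := exists_child_all_arcs hD hle hN (c x) (fun s => a x s)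
    (fun s s' h => by simpa using h) (fun s => by simp [parent]) (fun s => by simp [IsSingle])
  have h1 : outdeg D (a x s, j) = k := by
    refine outdeg_eq_of_fiber (hs j) fun w hw => ?_
    rcases hD.adj hw with h | h
    · exact (Option.some.inj h.1).symm
    · exact absurd h.1 (parent_ne_a _ _ _)
  have := hne (a x s, j) (c x, j) (.inl ⟨by simp [parent], by simp [IsSingle]⟩)
  omega

/-- Take a child `p` sending all its arcs up. If a vertex over it also sends one down to the node
`l`, it has outdegree `k + 1`. If none does, the vertices over `p` and the one in use over `l` all
have outdegree `k`, although adjacent. -/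
theorem outdeg_centre_ne_succ (x : Fin N × Option (Fin N)) (j : Fin k) :
    outdeg D (c x, j) ≠ k + 1 := by
  obtain ⟨s, hs⟩ := exists_child_all_arcs hD hle hN (c x) (fun s => p x s)
    (fun s s' h => by simpa using h) (fun s => by simp [parent]) (fun s => by simp [IsSingle])
  let o : Fin k := ⟨0, hk⟩
  have hnb : ∀ i w, D (p x s, i) w → w.1 = c x ∨ w = (l x s, o) := by
    intro i w hw
    rcases hD.adj hw with h | h
    · exact .inl (Option.some.inj h.1).symm
    · have h1 := eq_of_parent_eq_p h.1
      exact .inr (Prod.ext h1 (Fin.ext (h.2 (by simp [h1, IsSingle]))))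
  have hadj : ∀ i, (blowUp k N).Adj (l x s, o) (p x s, i) := fun i => .inl ⟨rfl, fun _ => rfl⟩
  by_cases hex : ∃ i, D (p x s, i) (l x s, o)
  · obtain ⟨i, hi⟩ := hex
    have h1 : outdeg D (p x s, i) = k + 1 := by
      have h2 : ({w | D (p x s, i) w} : Finset (Node N × Fin k)) =
          insert (l x s, o) ({w | w.1 = c x} : Finset (Node N × Fin k)) := by
        ext ⟨w, i'⟩
        simp only [mem_filter, mem_univ, true_and, mem_insert]
        constructor
        · exact fun h => (hnb i _ h).symm
        · rintro (h | rfl)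
          · rw [h]; exact hi
          · exact hs i i'
      unfold outdeg
      rw [h2, card_insert_of_notMem (by simp), card_fiber]
    have := hne (p x s, i) (c x, j) (.inl ⟨by simp [parent], by simp [IsSingle]⟩)
    omega
  · push Not at hex
    have h1 : outdeg D (l x s, o) = k := by
      refine outdeg_eq_of_fiber (y := p x s)
        (fun i => ((hD.adj_iff _ _).1 (hadj i)).resolve_right (hex i)) fun w hw => ?_
      rcases hD.adj hw with h | h
      · exact (Option.some.inj h.1).symm
      · exact absurd h.1 (parent_ne_l _ _ _)
    have h2 : outdeg D (p x s, o) = k := by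
      refine outdeg_eq_of_fiber (hs o) fun w hw => (hnb o w hw).resolve_right ?_
      rintro rfl
      exact hex o hw
    exact absurd (h1.trans h2.symm) (hne _ _ (hadj o))

/-- A centre sending all its arcs up has outdegree at least `k`, hence `k + 2`. Below each centre
`(j, none)` there is such a centre, which forbids `k + 2` at `(j, none)`; yet one of these sends all
its arcs to the root. -/
theorem not_proper_blowUp : False := by
  have hne1 := outdeg_centre_ne hD hle hne hN
  have hne2 := outdeg_centre_ne_succ hD hle hne hk hN
  have hN0 : 0 < N := by omega
  have hne3 : ∀ i j, outdeg D (c (j, none), i) ≠ k + 2 := by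
    intro i j
    obtain ⟨t, ht⟩ := exists_child_all_arcs hD hle hN (c (j, none)) (fun t => c (j, some t))
      (fun s s' h => by simpa using h) (fun s => by simp [parent]) (fun s => by simp [IsSingle])
    have h1 := le_outdeg_of_fiber (ht i)
    have h2 := hne1 (j, some t) i
    have h3 := hne2 (j, some t) i
    have h4 := hle (c (j, some t), i)
    have h5 := hne (c (j, some t), i) (c (j, none), i) (.inl ⟨by simp [parent], by simp [IsSingle]⟩)
    omega
  obtain ⟨j, hj⟩ := exists_child_all_arcs hD hle hN root (fun j => c (j, none))
    (fun s s' h => by simpa using h) (fun s => by simp [parent]) (fun s => by simp [IsSingle])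
  let o : Fin k := ⟨0, hk⟩
  have h1 := le_outdeg_of_fiber (hj o)
  have h2 := hne1 (j, none) o
  have h3 := hne2 (j, none) o
  have h4 := hne3 o j
  have h5 := hle (c (j, none), o)
  omega

end

theorem add_three_le_properChromaticNumber_blowUp (hk : 1 ≤ k) (hN : k * (k + 2) < N) :
    ((k + 3 : ℕ) : ℕ∞) ≤ (blowUp k N).properChromaticNumber :=
  le_properChromaticNumber fun _ hD hlt =>
    not_proper_blowUp hD.toIsOrientation.orients (fun v => Nat.le_of_lt_succ (hlt v))
      (fun _ _ huv => hD.outdeg_ne huv) hk hN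

end TightExample

end SimpleGraph

theorem mainTheorem3 :
    (∀ {V : Type*} [Finite V] (G : SimpleGraph V), G.IsBipartite →
      ((⌈(1 / 2 : ℝ) * G.maxAvgDegree⌉₊ : ℕ) : ℕ∞) ≤ G.properChromaticNumber ∧
      G.properChromaticNumber ≤ ((⌈(1 / 2 : ℝ) * G.maxAvgDegree⌉₊ + 3 : ℕ) : ℕ∞)) ∧
    (∀ k : ℕ, 1 ≤ k → ∃ (W : Type) (_ : Finite W) (G : SimpleGraph W), G.IsBipartite ∧
      ⌈(1 / 2 : ℝ) * G.maxAvgDegree⌉₊ = k ∧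
      G.properChromaticNumber = ((k + 3 : ℕ) : ℕ∞)) := by
  refine ⟨fun G hG => ⟨SimpleGraph.ceil_maxAvgDegree_le_properChromaticNumber, hG.properChromaticNumber_le⟩,
    fun k hk => ⟨SimpleGraph.Node (k * (k + 2) + 1) × Fin k, inferInstance,
      SimpleGraph.blowUp k (k * (k + 2) + 1),
      SimpleGraph.blowUp_isBipartite, ?_⟩⟩
  have h1 : ⌈(1 / 2 : ℝ) * (SimpleGraph.blowUp k (k * (k + 2) + 1)).maxAvgDegree⌉₊ ≤ k :=
    SimpleGraph.ceil_maxAvgDegree_blowUp_le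
  have h2 := SimpleGraph.add_three_le_properChromaticNumber_blowUp hk (Nat.lt_succ_self (k * (k + 2)))
  have h3 := (SimpleGraph.blowUp_isBipartite (k := k) (N := k * (k + 2) + 1)).properChromaticNumber_le
  -- The general upper bound supplies the missing inequality `k ≤ ⌈MAD/2⌉`.
  have h4 : k + 3 ≤ ⌈(1 / 2 : ℝ) * (SimpleGraph.blowUp k (k * (k + 2) + 1)).maxAvgDegree⌉₊ + 3 := by
    exact_mod_cast h2.trans h3
  have h5 : ⌈(1 / 2 : ℝ) * (SimpleGraph.blowUp k (k * (k + 2) + 1)).maxAvgDegree⌉₊ = k := by omega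
  rw [h5] at h3
  exact ⟨h5, le_antisymm h3 h2⟩
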